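/- **Theorem 1.4.** Let $(\mathcal G,\partial)$ be an additive arithmetical semigroup: $\mathcal G$ is a commutative monoid, written additively with identity $e_{\mathcal G}$, freely generated by a set $\mathcal P$ of primes, and $\partial:\mathcal G\to\mathbb Z_{\ge 0}$ is an additive degree map with $\partial(P)>0$ for all $P\in\mathcal P$ and only finitely many elements of degree at most $n$ for each $n$. Let $G^{\#}(n)$ be the number of elements of degree $n$, and assume Axiom $A^{\#}$: there are constants $c>0$, $q>1$, $0\le\eta<1$ with $$G^{\#}(n)=c\,q^{n}+O(q^{\eta n})\qquad(n\to\infty).$$ Let $Z_{\mathcal G}$ be the zeta function of $\mathcal G$, given by $Z_{\mathcal G}(z)=\prod_{P\in\mathcal P}(1-z^{\partial(P)})^{-1}$ for $|z|<q^{-1}$ and by holomorphic continuation on $\{|z|<q^{-\eta}\}\setminus\{q^{-1}\}$, and assume $Z_{\mathcal G}(-q^{-1})\ne 0$. Put $\|g\|=q^{\partial(g)}$. Let $S\subseteq\mathcal P$ have natural density $\delta(S)$, i.e. the limit $$\delta(S)=\lim_{n\to\infty}\frac{\#\{P\in S:\partial(P)=n\}}{\#\{P\in\mathcal P:\partial(P)=n\}}$$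 exists. Write $h\mid g$ if $g=h+r$ for some $r\in\mathcal G$. Call $g\ne e_{\mathcal G}$ distinguishable if exactly one of the (distinct) primes dividing $g$ has the minimal degree among them; this prime is denoted $P_{\min}(g)$. Let $$\mathfrak D(\mathcal G,S)=\{g\in\mathcal G: g\text{ is distinguishable and }P_{\min}(g)\in S\}\cup\{e_{\mathcal G}\}.$$ Let $\mu(g)=(-1)^k$ if $g$ is a sum of $k\ge 0$ distinct primes and $\mu(g)=0$ otherwise, and let $(\mu*a)(g)=\sum_{h+r=g}\mu(h)a(r)$ for $a:\mathcal G\to\mathbb C$. Suppose that $a:\mathcal G\to\mathbb C$ vanishes outside $\mathfrak D(\mathcal G,S)$, that $a(e_{\mathcal G})=1$, and that $$\lim_{n\to\infty}\sum_{\substack{1\le\partial(g)\le n\\ g\in\mathfrak D(\mathcal G,S)}}\frac{|a(g)|}{\|g\|}\log\log\|g\|<\infty .$$ Then $$-\lim_{n\to\infty}\sum_{\substack{1\le\partial(g)\le n\\ g\in\mathfrak D(\mathcal G,S)}}\frac{(\mu*a)(g)}{\|g\|}=\delta(S).$$ In particular, taking $a(e_{\mathcal G})=1$ and $a(g)=0$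 for $g\neq e_{\mathcal G}$, $$-\lim_{n\to\infty}\sum_{\substack{1\le\partial(g)\le n\\ g\in\mathfrak D(\mathcal G,S)}}\frac{\mu(g)}{\|g\|}=\delta(S).$$ -/

import Mathlib

open Filter Topology Asymptotics

/-- An additive arithmetical semigroup: a commutative monoid `G` (written additively, with
identity `0`) freely generated by a set `primes`, together with an additive degree map
`deg : G → ℕ` that is positive on primes and such that, for every bound `n`, only finitely many
elements have degree at most `n`. (Countability of `primes` follows.) -/
structure AdditiveArithmeticalSemigroup (G : Type*) [AddCommMonoid G] where
  /-- the set of primes -/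
  primes : Set G
  /-- every element is a finite sum `∑ aᵢ Pᵢ` of primes, in a unique way -/
  free : Function.Bijective
    (fun f : primes →₀ ℕ => f.sum (fun (P : primes) (k : ℕ) => k • (P : G)))
  /-- the degree map -/
  deg : G →+ ℕ
  deg_pos : ∀ P ∈ primes, 0 < deg P
  finite_deg_le : ∀ n : ℕ, {g : G | deg g ≤ n}.Finite

namespace AdditiveArithmeticalSemigroup

variable {G : Type*} [AddCommMonoid G] (A : AdditiveArithmeticalSemigroup G)

/-- `h ∣ g` in the additive monoid: there is `r` with `h + r = g`. -/
def Divides (h g : G) : Prop := ∃ r : G, h + r = g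

/-- The set of prime factors of `g`. -/
def primeFactors (g : G) : Set G := {P : G | P ∈ A.primes ∧ Divides P g}

/-- The number `G^#(n)` of elements of degree `n`. -/
noncomputable def countDeg (n : ℕ) : ℕ := {g : G | A.deg g = n}.ncard

/-- The number of elements of degree `n` in a set `S` (of primes). -/
noncomputable def primeCount (S : Set G) (n : ℕ) : ℕ := {P : G | P ∈ S ∧ A.deg P = n}.ncard

/-- `S` has natural density `δ`: `#{P ∈ S : ∂P = n} / #{P prime : ∂P = n} → δ`. -/
def HasNaturalDensity (S : Set G) (δ : ℝ) : Prop :=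
  Tendsto (fun n : ℕ => (A.primeCount S n : ℝ) / (A.primeCount A.primes n : ℝ)) atTop (𝓝 δ)

/-- Axiom `A^#` with constants `c > 0`, `q > 1`, `0 ≤ η < 1`:
`G^#(n) = c q ^ n + O(q ^ (η n))`. -/
structure AxiomASharp (c q η : ℝ) : Prop where
  c_pos : 0 < c
  one_lt_q : 1 < q
  eta_nonneg : 0 ≤ η
  eta_lt_one : η < 1
  isBigO : (fun n : ℕ => (A.countDeg n : ℝ) - c * q ^ n) =O[atTop]
    (fun n : ℕ => q ^ (η * (n : ℝ)))

/-- `Z` is the zeta function of the semigroup: it is given by the Euler product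
`∏_P (1 - z ^ ∂P)⁻¹` for `|z| < q⁻¹`, and on the larger disc `|z| < q ^ (-η)` punctured at
`q⁻¹` it is the holomorphic continuation of that product. (The punctured disc is connected, so
these conditions determine `Z` on it, in particular at `-q⁻¹`.) -/
structure IsZetaFunction (q η : ℝ) (Z : ℂ → ℂ) : Prop where
  eulerProduct : ∀ z : ℂ, ‖z‖ < q⁻¹ →
    HasProd (fun P : A.primes => (1 - z ^ A.deg (P : G))⁻¹) (Z z)
  holomorphic : DifferentiableOn ℂ Z (Metric.ball 0 (q ^ (-η)) \ {(q : ℂ)⁻¹})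

open Classical in
/-- The Möbius function: `0` if `2P ∣ g` for some prime `P`, and otherwise `(-1) ^ k`, where `k`
is the number of primes dividing `g`. -/
noncomputable def moebius (g : G) : ℤ :=
  if ∃ P ∈ A.primes, Divides (P + P) g then 0 else (-1) ^ (A.primeFactors g).ncard

/-- The minimum degree `d_-(g)` of the prime factors of `g` (for `g ≠ 0`). -/
noncomputable def minDeg (g : G) : ℕ := sInf (A.deg '' A.primeFactors g)

/-- `P` is a prime factor of `g` that attains the minimum degree `d_-(g)`. -/
def IsMinPrimeFactor (P g : G) : Prop := P ∈ A.primeFactors g ∧ A.deg P = A.minDeg g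

/-- `g` is distinguishable: `g ≠ 0` and exactly one prime factor of `g` attains the minimum
degree. (That prime may divide `g` with multiplicity.) -/
def IsDistinguishable (g : G) : Prop := g ≠ 0 ∧ ∃! P : G, A.IsMinPrimeFactor P g

/-- The distinguished set `𝔇(G, S)`: the distinguishable elements whose minimal prime factor lies
in `S`, together with the identity. -/
def distinguishedSet (S : Set G) : Set G :=
  {g : G | A.IsDistinguishable g ∧ ∃ P ∈ S, A.IsMinPrimeFactor P g} ∪ {0}

theorem finite_addPairs (A : AdditiveArithmeticalSemigroup G) (g : G) : {p : G × G | p.1 + p.2 = g}.Finite := by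
  refine ((A.finite_deg_le (A.deg g)).prod (A.finite_deg_le (A.deg g))).subset ?_
  rintro ⟨h, r⟩ hp
  have e : A.deg h + A.deg r = A.deg g := by
    rw [← map_add]; exact congrArg A.deg hp
  simp only [Set.mem_prod, Set.mem_ofPred_eq]
  omega

/-- Dirichlet convolution: the (finite) sum of `u h * v r` over all pairs with `h + r = g`. -/
noncomputable def dirichletConv (u v : G → ℂ) (g : G) : ℂ :=
  ∑ p ∈ (A.finite_addPairs g).toFinset, u p.1 * v p.2

theorem finite_distinguished (S : Set G) (n : ℕ) :
    {g : G | 1 ≤ A.deg g ∧ A.deg g ≤ n ∧ g ∈ A.distinguishedSet S}.Finite :=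
  (A.finite_deg_le n).subset fun _ hg => hg.2.1

/-- The finite set of all `g ∈ 𝔇(G, S)` with `1 ≤ ∂g ≤ n`. -/
noncomputable def distinguishedUpTo (S : Set G) (n : ℕ) : Finset G :=
  (A.finite_distinguished S n).toFinset

end AdditiveArithmeticalSemigroup

/-!
# Duality for the smallest prime factor in an additive arithmetical semigroup

Everything is expressed through power series in the normalized variable, in which `g` has weight
`(X / q) ^ ∂g` and the zeta function `ζ` has its pole at `X = 1`. For a finite set `F` of primes
let `Y_F = ∏ P ∈ F, (1 - (X / q) ^ ∂P)⁻¹`.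

*Analytic input.* Let `K = (1 - X) ζ`. Axiom A# makes the coefficients of `K` decay
geometrically, and `K` has no zero in the closed unit disc: inside by Möbius inversion, at `1`
because `c > 0`, at `-1` by hypothesis, and elsewhere on the circle by the 3-4-1 inequality. So
`1 / K` is holomorphic on a larger disc and its coefficients are absolutely summable
(`AxiomASharp.summable_abs_coeff_inv_regZeta`). Together with the logarithmic derivative of `ζ`
this gives Chebyshev's bound `O(q ^ n / n)` for the number of primes of degree `n`
(`AxiomASharp.exists_card_primesEq_le`).

*Combinatorial input.* The `n`-th coefficient of `Y_F / K` is the sum of `μ(g) / ‖g‖` over the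
`g` of degree at most `n` without prime factor in `F` (`coeff_roughSeries`). If `F` consists of
the primes of degree at most `∂P`, then the `n`-th coefficient of `-(X / q) ^ ∂P * Y_F / K` is
the same sum over the `g` whose unique smallest prime is `P` (`sum_isUniqueMin_moebius`). Write
`v_P(n)` for the negative of this coefficient; the quantity to be estimated is the sum of
`v_P(n)` over `P ∈ S`.

*Telescoping.* Adjoining to `F` all primes of degree `k` changes `Y_F / K` by the sum of the
series of these primes, up to an error that is quadratic in `#{P : ∂P = k} / q ^ k = O(1 / k)`
(`abs_coeff_eulerProd_union_sub_le`). The errors are therefore dominated by a convergent series,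
and each of them tends to `0` as `n → ∞`; hence the sum of `v_P(n)` over all primes tends to
`1`. The same telescoping applied to `Y_F`, where every term is non-negative, shows after
multiplication by `1 / K` that the sum of `|v_P(n)|` is bounded. As `v_P(n)` depends only on
`∂P` and tends to `0` for fixed `P`, a Toeplitz argument gives the limit `δ` when `P` is
restricted to a set of density `δ` (`AxiomASharp.tendsto_sum_filter_coeff_minPrimeSeries`).

*General `a`.* The sum of `(μ * a)(g) / ‖g‖` is `∑ r, a(r) / ‖r‖ * W_r`, where `W_r` is the sum
of `μ(h) / ‖h‖` over those `h` of degree at most `n - ∂r` for which `h + r` is distinguished.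
For `r = 0` this is the sum treated above. For `r ≠ 0` the smallest prime of `h + r` is that of
`r` or a smaller prime of `h`, so `W_r` is a finite combination of the coefficients above
(`shiftedSum_eq`): it is bounded uniformly in `r` and tends to `0`, and dominated convergence
leaves only `r = 0`.
-/

namespace AdditiveArithmeticalSemigroup

variable {G : Type*} [AddCommMonoid G] (A : AdditiveArithmeticalSemigroup G)

/-! ### Exponent vectors and divisibility -/

/-- The isomorphism of `G` with the free commutative monoid on its primes: the exponent of each
prime in the factorization of an element. -/
noncomputable def exponents : G ≃+ (A.primes →₀ ℕ) :=
  (AddEquiv.ofBijective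
    (Finsupp.linearCombination ℕ (Subtype.val : A.primes → G)).toAddMonoidHom A.free).symm

theorem exponents_prime (P : A.primes) : A.exponents (P : G) = Finsupp.single P 1 := by
  have h : A.exponents.symm (Finsupp.single P 1) = (P : G) := by
    change Finsupp.linearCombination ℕ (Subtype.val : A.primes → G) _ = _
    simp
  rw [← h, AddEquiv.apply_symm_apply]

theorem divides_iff_exponents_le {h g : G} : Divides h g ↔ A.exponents h ≤ A.exponents g := by
  constructor
  · rintro ⟨r, rfl⟩
    simp
  · intro hle
    refine ⟨A.exponents.symm (A.exponents g - A.exponents h), A.exponents.injective ?_⟩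
    rw [map_add, AddEquiv.apply_symm_apply, add_tsub_cancel_of_le hle]

theorem prime_divides_iff (P : A.primes) {g : G} :
    Divides (P : G) g ↔ 1 ≤ A.exponents g P := by
  rw [divides_iff_exponents_le, exponents_prime, Finsupp.single_le_iff]

theorem prime_add_prime_divides_iff (P : A.primes) {g : G} :
    Divides ((P : G) + P) g ↔ 2 ≤ A.exponents g P := by
  rw [divides_iff_exponents_le, map_add, exponents_prime, ← Finsupp.single_add,
    Finsupp.single_le_iff]

theorem add_left_injective (A : AdditiveArithmeticalSemigroup G) (r : G) :
    Function.Injective (fun h : G => r + h) := by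
  intro a b hab
  apply A.exponents.injective
  have := congrArg A.exponents hab
  simpa using this

theorem prime_divides_add_iff (P : A.primes) {g h : G} :
    Divides (P : G) (g + h) ↔ Divides (P : G) g ∨ Divides (P : G) h := by
  simp only [prime_divides_iff, map_add, Finsupp.add_apply]
  omega

theorem prime_divides_prime_iff (P Q : A.primes) : Divides (P : G) (Q : G) ↔ P = Q := by
  classical
  rw [prime_divides_iff, exponents_prime, Finsupp.single_apply]
  rw [eq_comm (a := P)]
  split_ifs with h <;> simp [h]

theorem not_prime_divides_zero (P : A.primes) : ¬ Divides (P : G) 0 := by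
  simp [prime_divides_iff]

theorem exists_prime_divides {g : G} (hg : g ≠ 0) : ∃ P : A.primes, Divides (P : G) g := by
  by_contra! h
  apply hg
  apply A.exponents.injective
  ext P
  have := h P
  rw [prime_divides_iff] at this
  simp only [map_zero, Finsupp.coe_zero, Pi.zero_apply]
  omega

theorem deg_le_of_divides {h g : G} (hd : Divides h g) : A.deg h ≤ A.deg g := by
  obtain ⟨r, rfl⟩ := hd
  simp

theorem eq_zero_of_deg_eq_zero {g : G} (hg : A.deg g = 0) : g = 0 := by
  by_contra h
  obtain ⟨P, hP⟩ := A.exists_prime_divides h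
  have := A.deg_le_of_divides hP
  have := A.deg_pos P P.2
  omega

theorem finite_primeFactors (g : G) : (A.primeFactors g).Finite :=
  (A.finite_deg_le (A.deg g)).subset fun _ hP => A.deg_le_of_divides hP.2

/-! ### The Möbius function -/

theorem moebius_zero : A.moebius 0 = 1 := by
  have h1 : ¬ ∃ P ∈ A.primes, Divides (P + P) (0 : G) := by
    rintro ⟨P, hP, h⟩
    have := (A.prime_add_prime_divides_iff ⟨P, hP⟩).1 h
    simp at this
  have h2 : A.primeFactors 0 = ∅ := by
    ext P
    simp only [primeFactors, Set.mem_ofPred_eq, Set.mem_empty_iff_false, iff_false, not_and]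
    exact fun hP => A.not_prime_divides_zero ⟨P, hP⟩
  rw [moebius, if_neg h1, h2]
  simp

theorem abs_moebius_le_one (g : G) : |(A.moebius g : ℝ)| ≤ 1 := by
  unfold moebius
  split_ifs <;> simp

theorem moebius_prime_add_of_divides (P : A.primes) {h : G} (hd : Divides (P : G) h) :
    A.moebius (P + h) = 0 := by
  rw [moebius, if_pos]
  refine ⟨P, P.2, ?_⟩
  rw [prime_divides_iff] at hd
  rw [prime_add_prime_divides_iff, map_add, exponents_prime]
  simp only [Finsupp.add_apply, Finsupp.single_eq_same]
  omega

theorem moebius_prime_add_of_not_divides (P : A.primes) {h : G} (hd : ¬ Divides (P : G) h) :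
    A.moebius (P + h) = - A.moebius h := by
  classical
  have hsq : (∃ Q ∈ A.primes, Divides (Q + Q) ((P : G) + h)) ↔
      ∃ Q ∈ A.primes, Divides (Q + Q) h := by
    refine exists_congr fun Q => and_congr_right fun hQ => ?_
    have e := A.prime_add_prime_divides_iff ⟨Q, hQ⟩ (g := (P : G) + h)
    have e' := A.prime_add_prime_divides_iff ⟨Q, hQ⟩ (g := h)
    simp only at e e'
    rw [e, e', map_add, exponents_prime, Finsupp.add_apply, Finsupp.single_apply]
    rw [prime_divides_iff] at hd
    split_ifs with hPQ
    · subst hPQ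
      omega
    · simp
  have hpf : A.primeFactors ((P : G) + h) = insert (P : G) (A.primeFactors h) := by
    ext Q
    simp only [primeFactors, Set.mem_ofPred_eq, Set.mem_insert_iff]
    constructor
    · rintro ⟨hQ, hdiv⟩
      rcases (A.prime_divides_add_iff ⟨Q, hQ⟩).1 hdiv with h1 | h1
      · exact Or.inl (congrArg Subtype.val ((A.prime_divides_prime_iff ⟨Q, hQ⟩ P).1 h1))
      · exact Or.inr ⟨hQ, h1⟩
    · rintro (rfl | ⟨hQ, h1⟩)
      · exact ⟨P.2, h, rfl⟩
      · exact ⟨hQ, (A.prime_divides_add_iff ⟨Q, hQ⟩).2 (Or.inr h1)⟩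
  have hcard : (A.primeFactors ((P : G) + h)).ncard = (A.primeFactors h).ncard + 1 := by
    rw [hpf, Set.ncard_insert_of_notMem (fun hm => hd hm.2) (A.finite_primeFactors h)]
  unfold moebius
  simp only [hsq, hcard]
  split_ifs
  · simp
  · rw [pow_succ]; ring

/-! ### Generating functions by degree -/

theorem finite_deg_eq (n : ℕ) : {g : G | A.deg g = n}.Finite :=
  (A.finite_deg_le n).subset fun _ hg => le_of_eq hg

/-- The finite set of elements of degree `n`. -/
noncomputable def degEq (n : ℕ) : Finset G := (A.finite_deg_eq n).toFinset

/-- The finite set of elements of degree at most `n`. -/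
noncomputable def degLE (n : ℕ) : Finset G := (A.finite_deg_le n).toFinset

@[simp] theorem mem_degEq {n : ℕ} {g : G} : g ∈ A.degEq n ↔ A.deg g = n := by simp [degEq]

@[simp] theorem mem_degLE {n : ℕ} {g : G} : g ∈ A.degLE n ↔ A.deg g ≤ n := by simp [degLE]

theorem card_degEq (n : ℕ) : (A.degEq n).card = A.countDeg n :=
  (Set.ncard_eq_toFinset_card _ (A.finite_deg_eq n)).symm

/-- The normalized generating function `∑ g, f g * (X / q) ^ ∂g`. The factor `q ^ (-∂g)` places the
pole of the zeta function at `X = 1`. -/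
noncomputable def genFun (q : ℝ) (f : G → ℝ) : PowerSeries ℝ :=
  PowerSeries.mk fun n => ∑ g ∈ A.degEq n, f g / q ^ A.deg g

/-- The monomial `(X / q) ^ ∂r`. -/
noncomputable def degMonomial (q : ℝ) (r : G) : PowerSeries ℝ :=
  PowerSeries.C (q ^ A.deg r)⁻¹ * PowerSeries.X ^ A.deg r

theorem coeff_genFun (q : ℝ) (f : G → ℝ) (n : ℕ) :
    PowerSeries.coeff n (A.genFun q f) = ∑ g ∈ A.degEq n, f g / q ^ A.deg g := by
  simp [genFun]

theorem coeff_degMonomial_mul (q : ℝ) (r : G) (Φ : PowerSeries ℝ) (n : ℕ) :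
    PowerSeries.coeff n (A.degMonomial q r * Φ) =
      if A.deg r ≤ n then PowerSeries.coeff (n - A.deg r) Φ / q ^ A.deg r else 0 := by
  rw [degMonomial, mul_assoc, PowerSeries.coeff_C_mul,
    PowerSeries.coeff_X_pow_mul']
  split_ifs
  · rw [div_eq_inv_mul]
  · simp

theorem sum_degLE_eq_sum_coeff_genFun (q : ℝ) (f : G → ℝ) (n : ℕ) :
    ∑ g ∈ A.degLE n, f g / q ^ A.deg g =
      ∑ i ∈ Finset.range (n + 1), PowerSeries.coeff i (A.genFun q f) := by
  simp only [coeff_genFun]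
  rw [← Finset.sum_fiberwise_of_maps_to (s := A.degLE n) (t := Finset.range (n + 1))
    (g := fun g => A.deg g)
    (fun g hg => by
      rw [mem_degLE] at hg
      exact Finset.mem_range.2 (by omega))]
  refine Finset.sum_congr rfl fun i hi => Finset.sum_congr ?_ fun _ _ => rfl
  ext g
  simp only [Finset.mem_filter, mem_degLE, mem_degEq, Finset.mem_range] at hi ⊢
  omega

open Classical in
theorem genFun_ite_divides (q : ℝ) (r : G) (f : G → ℝ) :
    A.genFun q (fun g => if Divides r g then f g else 0) =
      A.degMonomial q r * A.genFun q (fun h => f (r + h)) := by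
  ext n
  rw [coeff_degMonomial_mul, coeff_genFun]
  simp only [ite_div, zero_div, ← Finset.sum_filter]
  split_ifs with hn
  · rw [coeff_genFun, Finset.sum_div]
    symm
    refine Finset.sum_bij (fun h _ => r + h) ?_ ?_ ?_ ?_
    · intro h hh
      rw [mem_degEq] at hh
      simp only [Finset.mem_filter, mem_degEq, map_add]
      exact ⟨by omega, h, rfl⟩
    · intro a _ b _ hab
      exact A.add_left_injective r hab
    · intro g hg
      simp only [Finset.mem_filter, mem_degEq] at hg
      obtain ⟨hg, h, rfl⟩ := hg
      refine ⟨h, ?_, rfl⟩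
      rw [map_add] at hg
      rw [mem_degEq]
      omega
    · intro h _
      rw [map_add, pow_add, div_div, mul_comm (q ^ A.deg r)]
  · refine Finset.sum_eq_zero fun g hg => ?_
    simp only [Finset.mem_filter, mem_degEq] at hg
    have := A.deg_le_of_divides hg.2
    omega

theorem genFun_add (q : ℝ) (f g : G → ℝ) :
    A.genFun q (fun x => f x + g x) = A.genFun q f + A.genFun q g := by
  ext n
  simp [coeff_genFun, add_div, Finset.sum_add_distrib]

theorem genFun_neg (q : ℝ) (f : G → ℝ) : A.genFun q (fun x => - f x) = - A.genFun q f := by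
  ext n
  simp [coeff_genFun, neg_div]

/-- The zeta function of the semigroup, in the normalized variable. -/
noncomputable def zetaSeries (q : ℝ) : PowerSeries ℝ := A.genFun q fun _ => 1

/-- No prime of `F` divides `g`. -/
def IsFreeOf (F : Finset A.primes) (g : G) : Prop := ∀ P ∈ F, ¬ Divides (P : G) g

open Classical in
/-- The generating function of the elements without prime factors in `F`. -/
noncomputable def freeSeries (q : ℝ) (F : Finset A.primes) : PowerSeries ℝ :=
  A.genFun q fun g => if A.IsFreeOf F g then 1 else 0

open Classical in
/-- The generating function of `μ` over the elements without prime factors in `F`. -/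
noncomputable def moebiusSeries (q : ℝ) (F : Finset A.primes) : PowerSeries ℝ :=
  A.genFun q fun g => if A.IsFreeOf F g then (A.moebius g : ℝ) else 0

/-- The reciprocal `∏ P ∈ F, (1 - (X / q) ^ ∂P)` of a partial Euler product. -/
noncomputable def eulerDenom (q : ℝ) (F : Finset A.primes) : PowerSeries ℝ :=
  ∏ P ∈ F, (1 - A.degMonomial q (P : G))

theorem isFreeOf_empty (g : G) : A.IsFreeOf ∅ g := by simp [IsFreeOf]

open Classical in
theorem isFreeOf_insert (P : A.primes) (F : Finset A.primes) (g : G) :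
    A.IsFreeOf (insert P F) g ↔ ¬ Divides (P : G) g ∧ A.IsFreeOf F g := by
  simp [IsFreeOf]

theorem isFreeOf_prime_add {P : A.primes} {F : Finset A.primes} (hP : P ∉ F) (g : G) :
    A.IsFreeOf F ((P : G) + g) ↔ A.IsFreeOf F g := by
  refine forall₂_congr fun Q hQ => ?_
  rw [prime_divides_add_iff, prime_divides_prime_iff]
  have : Q ≠ P := fun h => hP (h ▸ hQ)
  simp [this]

theorem isFreeOf_zero (F : Finset A.primes) : A.IsFreeOf F 0 :=
  fun P _ => A.not_prime_divides_zero P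

theorem freeSeries_empty (q : ℝ) : A.freeSeries q ∅ = A.zetaSeries q := by
  simp [freeSeries, zetaSeries, isFreeOf_empty]

open Classical in
theorem freeSeries_insert (q : ℝ) {P : A.primes} {F : Finset A.primes} (hP : P ∉ F) :
    A.freeSeries q (insert P F) = A.freeSeries q F * (1 - A.degMonomial q (P : G)) := by
  have h1 : A.freeSeries q F = A.freeSeries q (insert P F) + A.degMonomial q (P : G) *
      A.freeSeries q F := by
    have h2 := A.genFun_ite_divides q (P : G) (fun g => if A.IsFreeOf F g then 1 else 0)
    simp only [A.isFreeOf_prime_add hP] at h2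
    conv_lhs => rw [freeSeries]
    conv_rhs => rw [freeSeries, freeSeries]
    rw [← h2, ← genFun_add]
    congr 1
    ext g
    rw [isFreeOf_insert]
    by_cases h3 : Divides (P : G) g <;> by_cases h4 : A.IsFreeOf F g <;> simp [h3, h4]
  linear_combination -h1

open Classical in
theorem moebiusSeries_insert (q : ℝ) {P : A.primes} {F : Finset A.primes} (hP : P ∉ F) :
    A.moebiusSeries q F = A.moebiusSeries q (insert P F) * (1 - A.degMonomial q (P : G)) := by
  have h1 : A.moebiusSeries q F = A.moebiusSeries q (insert P F) + A.degMonomial q (P : G) *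
      (- A.moebiusSeries q (insert P F)) := by
    have h2 := A.genFun_ite_divides q (P : G)
      (fun g => if A.IsFreeOf F g then (A.moebius g : ℝ) else 0)
    conv_lhs => rw [moebiusSeries]
    conv_rhs => rw [moebiusSeries]
    rw [← genFun_neg]
    have h3 : (fun x => -(if A.IsFreeOf (insert P F) x then (A.moebius x : ℝ) else 0)) =
        fun h => if A.IsFreeOf F ((P : G) + h) then (A.moebius ((P : G) + h) : ℝ) else 0 := by
      ext x
      rw [A.isFreeOf_prime_add hP, isFreeOf_insert]
      by_cases h3 : Divides (P : G) x
      · rw [A.moebius_prime_add_of_divides P h3]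
        simp [h3]
      · rw [A.moebius_prime_add_of_not_divides P h3]
        by_cases h4 : A.IsFreeOf F x <;> simp [h3, h4]
    rw [h3, ← h2, ← genFun_add]
    congr 1
    ext g
    rw [isFreeOf_insert]
    by_cases h3 : Divides (P : G) g <;> by_cases h4 : A.IsFreeOf F g <;> simp [h3, h4]
  linear_combination h1

theorem freeSeries_eq (q : ℝ) (F : Finset A.primes) :
    A.freeSeries q F = A.zetaSeries q * A.eulerDenom q F := by
  classical
  induction F using Finset.induction_on with
  | empty => simp [freeSeries_empty, eulerDenom]
  | insert P F hP ih =>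
    rw [freeSeries_insert A q hP, ih, eulerDenom, eulerDenom, Finset.prod_insert hP]
    ring

theorem moebiusSeries_empty_eq (q : ℝ) (F : Finset A.primes) :
    A.moebiusSeries q ∅ = A.moebiusSeries q F * A.eulerDenom q F := by
  classical
  induction F using Finset.induction_on with
  | empty => simp [eulerDenom]
  | insert P F hP ih =>
    rw [ih, moebiusSeries_insert A q hP, eulerDenom, eulerDenom, Finset.prod_insert hP]
    ring

theorem finite_primes_deg_le (n : ℕ) : {P : A.primes | A.deg (P : G) ≤ n}.Finite :=
  (A.finite_deg_le n).preimage Subtype.val_injective.injOn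

/-- The finite set of primes of degree at most `n`. -/
noncomputable def primesLE (n : ℕ) : Finset A.primes := (A.finite_primes_deg_le n).toFinset

@[simp] theorem mem_primesLE {n : ℕ} {P : A.primes} : P ∈ A.primesLE n ↔ A.deg (P : G) ≤ n := by
  simp [primesLE]

theorem eq_zero_of_isFreeOf_primesLE {n : ℕ} {F : Finset A.primes} (hF : A.primesLE n ⊆ F) {g : G}
    (hg : A.deg g ≤ n) (h : A.IsFreeOf F g) : g = 0 := by
  by_contra h0
  obtain ⟨P, hP⟩ := A.exists_prime_divides h0
  exact h P (hF (A.mem_primesLE.2 ((A.deg_le_of_divides hP).trans hg))) hP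

open Classical in
theorem coeff_genFun_isFreeOf (q : ℝ) {n i : ℕ} {F : Finset A.primes} (hF : A.primesLE n ⊆ F)
    (hi : i ≤ n) (f : G → ℝ) (hf : f 0 = 1) :
    PowerSeries.coeff i (A.genFun q fun g => if A.IsFreeOf F g then f g else 0) =
      if i = 0 then 1 else 0 := by
  rw [coeff_genFun]
  split_ifs with h0
  · subst h0
    rw [Finset.sum_eq_single 0]
    · simp [isFreeOf_zero, hf]
    · intro b hb hb0
      exact absurd (A.eq_zero_of_deg_eq_zero (A.mem_degEq.1 hb)) hb0
    · intro h
      simp at h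
  · refine Finset.sum_eq_zero fun g hg => ?_
    rw [mem_degEq] at hg
    rw [if_neg, zero_div]
    intro h
    have := A.eq_zero_of_isFreeOf_primesLE hF (by omega) h
    subst this
    simp at hg
    omega

theorem coeff_freeSeries (q : ℝ) {n i : ℕ} {F : Finset A.primes} (hF : A.primesLE n ⊆ F)
    (hi : i ≤ n) : PowerSeries.coeff i (A.freeSeries q F) = if i = 0 then 1 else 0 :=
  A.coeff_genFun_isFreeOf q hF hi (fun _ => 1) rfl

theorem coeff_moebiusSeries (q : ℝ) {n i : ℕ} {F : Finset A.primes} (hF : A.primesLE n ⊆ F)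
    (hi : i ≤ n) : PowerSeries.coeff i (A.moebiusSeries q F) = if i = 0 then 1 else 0 :=
  A.coeff_genFun_isFreeOf q hF hi (fun g => (A.moebius g : ℝ)) (by simp [moebius_zero])

/-- Möbius inversion, `(∑ μ(g) (X/q)^∂g) * ζ = 1`. For the primes `F` of degree at most `n`, both
factors agree with `∏ P ∈ F, (1 - (X/q)^∂P)` and its inverse up to degree `n`. -/
theorem moebiusSeries_mul_zetaSeries (q : ℝ) : A.moebiusSeries q ∅ * A.zetaSeries q = 1 := by
  ext n
  set F := A.primesLE n
  have h1 : A.moebiusSeries q ∅ * A.zetaSeries q = A.moebiusSeries q F * A.freeSeries q F := by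
    rw [A.moebiusSeries_empty_eq q F, freeSeries_eq]
    ring
  rw [h1, PowerSeries.coeff_mul, PowerSeries.coeff_one]
  have h2 : ∀ p ∈ Finset.HasAntidiagonal.antidiagonal n,
      PowerSeries.coeff p.1 (A.moebiusSeries q F) * PowerSeries.coeff p.2 (A.freeSeries q F) =
      (PowerSeries.coeff p.1 (1 : PowerSeries ℝ)) * PowerSeries.coeff p.2 (1 : PowerSeries ℝ) := by
    intro p hp
    rw [Finset.HasAntidiagonal.mem_antidiagonal] at hp
    rw [A.coeff_moebiusSeries q subset_rfl (by omega), A.coeff_freeSeries q subset_rfl (by omega),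
      PowerSeries.coeff_one, PowerSeries.coeff_one]
  rw [Finset.sum_congr rfl h2, ← PowerSeries.coeff_mul, one_mul, PowerSeries.coeff_one]

end AdditiveArithmeticalSemigroup

/-! ### Power series with summable coefficients -/

namespace PowerSeries

theorem eq_zero_of_hasSum_zero {Φ : PowerSeries ℂ}
    (h : ∀ z : ℂ, ‖z‖ < 1 → HasSum (fun n => coeff n Φ * z ^ n) 0) : Φ = 0 := by
  set p : FormalMultilinearSeries ℂ ℂ ℂ :=
    FormalMultilinearSeries.ofScalars ℂ (fun n => coeff n Φ) with hp
  have hr : ((1 / 2 : NNReal) : ENNReal) ≤ p.radius := by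
    apply FormalMultilinearSeries.le_radius_of_tendsto (l := 0)
    have h1 := (h (1 / 2) (by norm_num)).summable.tendsto_atTop_zero.norm
    refine (h1.congr fun n => ?_).trans (by simp)
    rw [hp, FormalMultilinearSeries.ofScalars_norm]
    simp
  have hf : HasFPowerSeriesOnBall (0 : ℂ → ℂ) p 0 ((1 / 2 : NNReal) : ENNReal) := by
    refine ⟨hr, by simp, fun {y} hy => ?_⟩
    have hy' : ‖y‖ < 1 := by
      rw [Metric.mem_eball, edist_zero_right, ← ofReal_norm,
        ENNReal.ofReal_lt_coe_iff (by norm_num)] at hy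
      refine hy.trans ?_
      norm_num
    convert! h y hy' using 2 with n
    simp [hp, mul_comm]
  have h0 := hf.hasFPowerSeriesAt.eq_zero
  have h1 : (fun n => coeff n Φ) = 0 := (FormalMultilinearSeries.ofScalars_series_eq_zero ℂ).1 h0
  ext n
  simpa using congrFun h1 n

theorem hasSum_coeff_mul {Φ Ψ : PowerSeries ℂ} {z : ℂ}
    (hΦ : Summable fun n => ‖coeff n Φ * z ^ n‖) (hΨ : Summable fun n => ‖coeff n Ψ * z ^ n‖) :
    HasSum (fun n => coeff n (Φ * Ψ) * z ^ n)
      ((∑' n, coeff n Φ * z ^ n) * ∑' n, coeff n Ψ * z ^ n) := by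
  have e : ∀ n, ∑ p ∈ Finset.HasAntidiagonal.antidiagonal n,
      (coeff p.1 Φ * z ^ p.1) * (coeff p.2 Ψ * z ^ p.2) = coeff n (Φ * Ψ) * z ^ n := by
    intro n
    rw [coeff_mul, Finset.sum_mul]
    refine Finset.sum_congr rfl fun p hp => ?_
    rw [← Finset.HasAntidiagonal.mem_antidiagonal.1 hp, pow_add]
    ring
  rw [tsum_mul_tsum_eq_tsum_sum_antidiagonal_of_summable_norm hΦ hΨ]
  have hs := (summable_norm_sum_mul_antidiagonal_of_summable_norm hΦ hΨ).of_norm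
  simp only [e] at hs ⊢
  exact hs.hasSum

theorem differentiableOn_tsum_coeff {K : PowerSeries ℂ} {C ρ r : ℝ} (hρ : 0 < ρ) (hr : 0 < r)
    (hρr : ρ * r < 1) (hK : ∀ n, ‖coeff n K‖ ≤ C * ρ ^ n) :
    DifferentiableOn ℂ (fun z => ∑' n, coeff n K * z ^ n) (Metric.ball 0 r) := by
  have hC : 0 ≤ C := by simpa using (norm_nonneg _).trans (hK 0)
  refine Complex.differentiableOn_tsum_of_summable_norm
    ((summable_geometric_of_lt_one (by positivity) hρr).mul_left C) (fun n => by fun_prop)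
    Metric.isOpen_ball fun n z hz => ?_
  rw [mem_ball_zero_iff] at hz
  rw [norm_mul, norm_pow, mul_pow, ← mul_assoc]
  gcongr
  exact hK n

/-- If `∑ kₙ zⁿ` has radius of convergence larger than `1` and no zero in the closed unit disc,
then the coefficients of its inverse are absolutely summable: the inverse is holomorphic on a
slightly larger disc. -/
theorem summable_norm_coeff_inv {K : PowerSeries ℂ} {C ρ : ℝ} (hρ : 0 < ρ) (hρ1 : ρ < 1)
    (hK : ∀ n, ‖coeff n K‖ ≤ C * ρ ^ n)
    (hne : ∀ z : ℂ, ‖z‖ ≤ 1 → ∑' n, coeff n K * z ^ n ≠ 0) :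
    Summable fun n => ‖coeff n K⁻¹‖ := by
  set f : ℂ → ℂ := fun z => ∑' n, coeff n K * z ^ n with hf
  obtain ⟨r, hr1, hrρ⟩ : ∃ r : ℝ, 1 < r ∧ r < ρ⁻¹ := exists_between (one_lt_inv_iff₀.2 ⟨hρ, hρ1⟩)
  have hρr : ρ * r < 1 := by
    have := mul_lt_mul_of_pos_left hrρ hρ
    rwa [mul_inv_cancel₀ hρ.ne'] at this
  have hdiff : DifferentiableOn ℂ f (Metric.ball 0 r) :=
    differentiableOn_tsum_coeff hρ (by linarith) hρr hK
  have hopen : IsOpen (Metric.ball (0 : ℂ) r ∩ f ⁻¹' {0}ᶜ) :=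
    hdiff.continuousOn.isOpen_inter_preimage Metric.isOpen_ball isOpen_compl_singleton
  have hsub : Metric.closedBall (0 : ℂ) 1 ⊆ Metric.ball (0 : ℂ) r ∩ f ⁻¹' {0}ᶜ := by
    intro z hz
    rw [mem_closedBall_zero_iff] at hz
    exact ⟨mem_ball_zero_iff.2 (by linarith), hne z hz⟩
  obtain ⟨ε, hε, hthick⟩ :=
    (isCompact_closedBall (0 : ℂ) 1).exists_thickening_subset_open hopen hsub
  rw [thickening_closedBall hε zero_le_one] at hthick
  set R : NNReal := ⟨1 + ε / 2, by positivity⟩ with hR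
  have hRval : (R : ℝ) = 1 + ε / 2 := rfl
  have hsub' : Metric.closedBall (0 : ℂ) R ⊆ Metric.ball (0 : ℂ) r ∩ f ⁻¹' {0}ᶜ := by
    refine (Metric.closedBall_subset_ball ?_).trans hthick
    rw [hRval]; linarith
  have hinv : DifferentiableOn ℂ (fun z => (f z)⁻¹) (Metric.closedBall 0 R) :=
    (hdiff.mono fun z hz => (hsub' hz).1).inv fun z hz => (hsub' hz).2
  have hRpos : 0 < R := by
    rw [← NNReal.coe_pos, hRval]; positivity
  have hps := hinv.hasFPowerSeriesOnBall hRpos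
  set p := cauchyPowerSeries (fun z => (f z)⁻¹) 0 R
  have h1R : ((1 : NNReal) : ENNReal) < p.radius := by
    refine lt_of_lt_of_le ?_ hps.r_le
    rw [ENNReal.coe_lt_coe, ← NNReal.coe_lt_coe, hRval, NNReal.coe_one]
    linarith
  have hsum : Summable fun n => ‖p.coeff n‖ := by
    have := p.summable_norm_mul_pow h1R
    simpa [FormalMultilinearSeries.norm_apply_eq_norm_coef] using this
  set B : PowerSeries ℂ := PowerSeries.mk p.coeff with hB
  have hle : ∀ {a : ℕ → ℂ} (_ : Summable fun n => ‖a n‖) {z : ℂ} (_ : ‖z‖ < 1),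
      Summable fun n => ‖a n * z ^ n‖ := by
    intro a ha z hz
    refine ha.of_nonneg_of_le (fun _ => norm_nonneg _) fun n => ?_
    rw [norm_mul, norm_pow]
    exact mul_le_of_le_one_right (norm_nonneg _) (pow_le_one₀ (norm_nonneg _) hz.le)
  have hKs : Summable fun n => ‖coeff n K‖ :=
    ((summable_geometric_of_lt_one hρ.le hρ1).mul_left C).of_nonneg_of_le
      (fun _ => norm_nonneg _) hK
  have hBK : B * K - 1 = 0 := by
    refine eq_zero_of_hasSum_zero fun z hz => ?_
    have h1 := hasSum_coeff_mul (Φ := B) (Ψ := K) (z := z)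
      (hle (by simpa [hB] using hsum) hz) (hle hKs hz)
    have h2 : ∑' n, coeff n B * z ^ n = (f z)⁻¹ := by
      have h3 := hps.hasSum (y := z) (by
        rw [Metric.mem_eball, edist_zero_right, ← ofReal_norm,
          ENNReal.ofReal_lt_coe_iff (norm_nonneg _), hRval]
        linarith)
      rw [zero_add] at h3
      rw [← h3.tsum_eq]
      refine tsum_congr fun n => ?_
      rw [FormalMultilinearSeries.apply_eq_pow_smul_coeff, smul_eq_mul, hB, coeff_mk, mul_comm]
    rw [h2, inv_mul_cancel₀ (hne z hz.le)] at h1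
    have h4 : HasSum (fun n => coeff n (1 : PowerSeries ℂ) * z ^ n) 1 := by
      convert! hasSum_ite_eq 0 (1 : ℂ) using 2 with n
      rw [coeff_one]
      split_ifs with h <;> simp [h]
    have h5 := h1.sub h4
    rw [sub_self] at h5
    convert! h5 using 2 with n
    rw [map_sub, sub_mul]
  have hK0 : constantCoeff K ≠ 0 := by
    have := congrArg constantCoeff (sub_eq_zero.1 hBK)
    rw [map_mul, map_one] at this
    exact right_ne_zero_of_mul (this ▸ one_ne_zero)
  have : K⁻¹ = B := (PowerSeries.inv_eq_iff_mul_eq_one hK0).2 (sub_eq_zero.1 hBK)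
  rw [this]
  simpa [hB] using hsum

end PowerSeries

/-- The inequality behind the non-vanishing of zeta functions on the boundary of the region of
convergence, for a single Euler factor; it comes from `3 + 4 cos θ + cos 2θ ≥ 0`. -/
theorem norm_euler_factor_product_le_one {a : ℝ} (ha₀ : 0 ≤ a) (ha₁ : a < 1) {z : ℂ}
    (hz : ‖z‖ = 1) :
    ‖(1 - a : ℂ)‖ ^ 3 * ‖1 - a * z‖ ^ 4 * ‖1 - a * z ^ 2‖ ≤ 1 := by
  have hac₀ : ‖(a : ℂ)‖ < 1 := by
    simp only [Complex.norm_of_nonneg ha₀, ha₁]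
  have hac₁ : ‖a * z‖ < 1 := by rwa [norm_mul, hz, mul_one]
  have hac₂ : ‖a * z ^ 2‖ < 1 := by rwa [norm_mul, norm_pow, hz, one_pow, mul_one]
  have key : 0 ≤ 3 * (-Complex.log (1 - a)).re + 4 * (-Complex.log (1 - a * z)).re +
      (-Complex.log (1 - a * z ^ 2)).re := by
    rw [← ((Complex.hasSum_re <| Complex.hasSum_taylorSeries_neg_log hac₀).mul_left 3).add
      ((Complex.hasSum_re <| Complex.hasSum_taylorSeries_neg_log hac₁).mul_left 4) |>.add
      (Complex.hasSum_re <| Complex.hasSum_taylorSeries_neg_log hac₂) |>.tsum_eq]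
    refine tsum_nonneg fun n ↦ ?_
    simp only [← Complex.ofReal_pow, Complex.div_natCast_re, Complex.ofReal_re, mul_pow,
      Complex.mul_re, Complex.ofReal_im, zero_mul, sub_zero]
    rcases n.eq_zero_or_pos with rfl | hn
    · simp
    · simp only [← mul_div_assoc, ← add_div]
      refine div_nonneg ?_ n.cast_nonneg
      rw [← pow_mul, pow_mul', sq, Complex.mul_re, ← sq, ← sq, ← Complex.sq_norm_sub_sq_re,
        norm_pow, hz]
      convert! (show 0 ≤ 2 * a ^ n * ((z ^ n).re + 1) ^ 2 by positivity) using 1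
      ring
  have hpos : ∀ w : ℂ, ‖w‖ < 1 → 0 < ‖1 - w‖ := by
    intro w hw
    rw [norm_pos_iff, sub_ne_zero]
    rintro rfl
    simp at hw
  have e : ∀ w : ℂ, ‖w‖ < 1 → ‖1 - w‖ = Real.exp (-(-Complex.log (1 - w)).re) := by
    intro w hw
    rw [Complex.neg_re, neg_neg, Complex.log_re, Real.exp_log (hpos w hw)]
  rw [e _ hac₀, e _ hac₁, e _ hac₂, ← Real.exp_nat_mul, ← Real.exp_nat_mul, ← Real.exp_add,
    ← Real.exp_add, Real.exp_le_one_iff]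
  push_cast
  linarith

namespace PowerSeries

theorem coeff_zero_one_sub_X_mul {R : Type*} [CommRing R] (Φ : PowerSeries R) :
    coeff 0 ((1 - X) * Φ) = coeff 0 Φ := by
  rw [sub_mul, one_mul, map_sub, coeff_zero_X_mul, sub_zero]

theorem coeff_succ_one_sub_X_mul {R : Type*} [CommRing R] (Φ : PowerSeries R) (n : ℕ) :
    coeff (n + 1) ((1 - X) * Φ) = coeff (n + 1) Φ - coeff n Φ := by
  rw [sub_mul, one_mul, map_sub, coeff_succ_X_mul]

theorem sum_coeff_one_sub_X_mul {R : Type*} [CommRing R] (Φ : PowerSeries R) (n : ℕ) :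
    ∑ i ∈ Finset.range (n + 1), coeff i ((1 - X) * Φ) = coeff n Φ := by
  induction n with
  | zero => rw [Finset.sum_range_one, coeff_zero_one_sub_X_mul]
  | succ n ih => rw [Finset.sum_range_succ, ih, coeff_succ_one_sub_X_mul]; ring

/-- The value at a complex point of a power series with real coefficients (`0` if the series
diverges). -/
noncomputable def evalC (Φ : PowerSeries ℝ) (z : ℂ) : ℂ := ∑' n, ((coeff n Φ : ℝ) : ℂ) * z ^ n

theorem summable_norm_evalC {Φ : PowerSeries ℝ} {B : ℝ} (hB : ∀ n, |coeff n Φ| ≤ B) {z : ℂ}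
    (hz : ‖z‖ < 1) : Summable fun n => ‖((coeff n Φ : ℝ) : ℂ) * z ^ n‖ := by
  refine ((summable_geometric_of_lt_one (norm_nonneg z) hz).mul_left B).of_nonneg_of_le
    (fun _ => norm_nonneg _) fun n => ?_
  rw [norm_mul, norm_pow, Complex.norm_real, Real.norm_eq_abs]
  gcongr
  exact hB n

theorem evalC_mul {Φ Ψ : PowerSeries ℝ} {B B' : ℝ} (hB : ∀ n, |coeff n Φ| ≤ B)
    (hB' : ∀ n, |coeff n Ψ| ≤ B') {z : ℂ} (hz : ‖z‖ < 1) :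
    evalC (Φ * Ψ) z = evalC Φ z * evalC Ψ z := by
  have h := hasSum_coeff_mul (Φ := Φ.map Complex.ofRealHom) (Ψ := Ψ.map Complex.ofRealHom) (z := z)
    (by simpa using summable_norm_evalC hB hz) (by simpa using summable_norm_evalC hB' hz)
  rw [← map_mul] at h
  simp only [coeff_map, Complex.ofRealHom_eq_coe] at h
  exact h.tsum_eq

theorem evalC_one (z : ℂ) : evalC 1 z = 1 := by
  rw [evalC, tsum_eq_single 0]
  · simp
  · intro n hn
    simp [coeff_one, hn]

theorem evalC_sub {Φ Ψ : PowerSeries ℝ} {B B' : ℝ} (hB : ∀ n, |coeff n Φ| ≤ B)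
    (hB' : ∀ n, |coeff n Ψ| ≤ B') {z : ℂ} (hz : ‖z‖ < 1) :
    evalC (Φ - Ψ) z = evalC Φ z - evalC Ψ z := by
  rw [evalC, evalC, evalC, ← (summable_norm_evalC hB hz).of_norm.tsum_sub
    (summable_norm_evalC hB' hz).of_norm]
  refine tsum_congr fun n => ?_
  rw [map_sub]
  push_cast
  ring

theorem norm_evalC_le {Φ : PowerSeries ℝ} (hs : Summable fun n => |coeff n Φ|) {z : ℂ}
    (hz : ‖z‖ ≤ 1) : ‖evalC Φ z‖ ≤ ∑' n, |coeff n Φ| := by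
  refine tsum_of_norm_bounded hs.hasSum fun n => ?_
  rw [norm_mul, norm_pow, Complex.norm_real, Real.norm_eq_abs]
  exact mul_le_of_le_one_right (abs_nonneg _) (pow_le_one₀ (norm_nonneg _) hz)

theorem norm_evalC_sub_le {Φ : PowerSeries ℝ} (hs : Summable fun n => |coeff n Φ|)
    (hs' : Summable fun n : ℕ => (n : ℝ) * |coeff n Φ|) {r : ℝ} (hr : 0 ≤ r)
    (hr1 : r ≤ 1) {w : ℂ} (hw : ‖w‖ = 1) :
    ‖evalC Φ (r * w) - evalC Φ w‖ ≤
      (1 - r) * ∑' n : ℕ, (n : ℝ) * |coeff n Φ| := by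
  have hsum : ∀ z : ℂ, ‖z‖ ≤ 1 →
      Summable fun n => ((coeff n Φ : ℝ) : ℂ) * z ^ n := fun z hz => by
    refine Summable.of_norm_bounded hs fun n => ?_
    rw [norm_mul, norm_pow, Complex.norm_real, Real.norm_eq_abs]
    exact mul_le_of_le_one_right (abs_nonneg _) (pow_le_one₀ (norm_nonneg _) hz)
  have hrw : ‖(r : ℂ) * w‖ ≤ 1 := by
    rwa [norm_mul, hw, mul_one, Complex.norm_real, Real.norm_eq_abs, abs_of_nonneg hr]
  rw [evalC, evalC, ← (hsum _ hrw).tsum_sub (hsum w hw.le)]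
  refine tsum_of_norm_bounded (hs'.hasSum.mul_left (1 - r)) fun n => ?_
  have e : ((coeff n Φ : ℝ) : ℂ) * (r * w) ^ n -
      ((coeff n Φ : ℝ) : ℂ) * w ^ n =
      ((coeff n Φ : ℝ) : ℂ) * w ^ n * ((r ^ n - 1 : ℝ) : ℂ) := by
    push_cast; ring
  rw [e, norm_mul, norm_mul, norm_pow, hw, one_pow, mul_one, Complex.norm_real, Complex.norm_real,
    Real.norm_eq_abs, Real.norm_eq_abs,
    abs_of_nonpos (a := r ^ n - 1) (by linarith [pow_le_one₀ hr hr1 (n := n)])]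
  have hb := one_add_mul_le_pow (a := r - 1) (by linarith) n
  rw [add_sub_cancel] at hb
  have : -(r ^ n - 1) ≤ n * (1 - r) := by linarith
  calc |coeff n Φ| * -(r ^ n - 1) ≤ |coeff n Φ| * (n * (1 - r)) := by gcongr
    _ = (1 - r) * (n * |coeff n Φ|) := by ring

end PowerSeries

namespace AdditiveArithmeticalSemigroup

variable {G : Type*} [AddCommMonoid G] (A : AdditiveArithmeticalSemigroup G)

/-! ### Consequences of Axiom A# for the coefficients -/

theorem coeff_zetaSeries (q : ℝ) (n : ℕ) :
    PowerSeries.coeff n (A.zetaSeries q) = A.countDeg n / q ^ n := by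
  rw [zetaSeries, coeff_genFun, ← card_degEq, Finset.card_eq_sum_ones, Nat.cast_sum,
    Finset.sum_div]
  refine Finset.sum_congr rfl fun g hg => ?_
  rw [A.mem_degEq.1 hg, Nat.cast_one]

/-- The zeta function with its pole at `X = 1` removed. -/
noncomputable def regZeta (q : ℝ) : PowerSeries ℝ := (1 - PowerSeries.X) * A.zetaSeries q

variable {A} {c q η : ℝ}

theorem AxiomASharp.q_pos (hA : A.AxiomASharp c q η) : 0 < q := zero_lt_one.trans hA.one_lt_q

theorem AxiomASharp.rpow_pos (hA : A.AxiomASharp c q η) : 0 < q ^ (η - 1) :=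
  Real.rpow_pos_of_pos hA.q_pos _

theorem AxiomASharp.rpow_lt_one (hA : A.AxiomASharp c q η) : q ^ (η - 1) < 1 :=
  Real.rpow_lt_one_of_one_lt_of_neg hA.one_lt_q (by linarith [hA.eta_lt_one])

theorem AxiomASharp.exists_abs_coeff_zeta_sub_le (hA : A.AxiomASharp c q η) :
    ∃ C : ℝ, ∀ n, |PowerSeries.coeff n (A.zetaSeries q) - c| ≤ C * (q ^ (η - 1)) ^ n := by
  have hq := hA.q_pos
  obtain ⟨C, hC⟩ := (isBigO_nat_atTop_iff (fun n h => absurd h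
    (Real.rpow_pos_of_pos hq _).ne')).1 hA.isBigO
  refine ⟨C, fun n => ?_⟩
  have h1 := hC n
  have hqn : 0 < q ^ n := pow_pos hq n
  rw [Real.norm_eq_abs, Real.norm_eq_abs, abs_of_pos (Real.rpow_pos_of_pos hq _)] at h1
  have h2 : q ^ (η * (n : ℝ)) = (q ^ (η - 1)) ^ n * q ^ n := by
    rw [← mul_pow, ← Real.rpow_add_one hq.ne', sub_add_cancel, ← Real.rpow_natCast,
      ← Real.rpow_mul hq.le]
  have h3 : (A.countDeg n : ℝ) - c * q ^ n =
      (PowerSeries.coeff n (A.zetaSeries q) - c) * q ^ n := by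
    rw [coeff_zetaSeries]
    field_simp
  rw [h3, h2, abs_mul, abs_of_pos hqn, ← mul_assoc] at h1
  exact le_of_mul_le_mul_right h1 hqn

theorem coeff_zetaSeries_nonneg (hq : 0 < q) (n : ℕ) :
    0 ≤ PowerSeries.coeff n (A.zetaSeries q) := by
  rw [coeff_zetaSeries]; positivity

theorem AxiomASharp.tendsto_coeff_zeta (hA : A.AxiomASharp c q η) :
    Tendsto (fun n => PowerSeries.coeff n (A.zetaSeries q)) atTop (𝓝 c) := by
  obtain ⟨C, hC⟩ := hA.exists_abs_coeff_zeta_sub_le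
  rw [tendsto_iff_norm_sub_tendsto_zero]
  refine squeeze_zero (fun _ => norm_nonneg _) hC ?_
  simpa using (tendsto_pow_atTop_nhds_zero_of_lt_one hA.rpow_pos.le hA.rpow_lt_one).const_mul C

theorem AxiomASharp.exists_coeff_zeta_le (hA : A.AxiomASharp c q η) :
    ∃ B : ℝ, ∀ n, PowerSeries.coeff n (A.zetaSeries q) ≤ B := by
  obtain ⟨B, hB⟩ := hA.tendsto_coeff_zeta.bddAbove_range
  exact ⟨B, fun n => hB ⟨n, rfl⟩⟩

theorem AxiomASharp.exists_abs_coeff_regZeta_le (hA : A.AxiomASharp c q η) :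
    ∃ C : ℝ, ∀ n, |PowerSeries.coeff n (A.regZeta q)| ≤ C * (q ^ (η - 1)) ^ n := by
  obtain ⟨C, hC⟩ := hA.exists_abs_coeff_zeta_sub_le
  have hρ := hA.rpow_pos
  set ρ := q ^ (η - 1)
  have hC0 : 0 ≤ C := by simpa using (abs_nonneg _).trans (hC 0)
  have hc := hA.c_pos
  refine ⟨C * (1 + ρ⁻¹) + c, fun n => ?_⟩
  rw [regZeta]
  cases n with
  | zero =>
    rw [PowerSeries.coeff_zero_one_sub_X_mul, pow_zero, mul_one]
    have h := abs_le.1 (hC 0)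
    rw [pow_zero, mul_one] at h
    have h' : 0 ≤ C * ρ⁻¹ := by positivity
    rw [abs_le]
    constructor <;> nlinarith
  | succ n =>
    rw [PowerSeries.coeff_succ_one_sub_X_mul]
    have h1 := abs_le.1 (hC (n + 1))
    have h2 := abs_le.1 (hC n)
    have h3 : (C * (1 + ρ⁻¹) + c) * ρ ^ (n + 1) =
        C * ρ ^ (n + 1) + C * ρ ^ n + c * ρ ^ (n + 1) := by
      rw [pow_succ]; field_simp
    have h4 : 0 ≤ c * ρ ^ (n + 1) := by positivity
    rw [h3, abs_le]
    constructor <;> linarith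

theorem AxiomASharp.summable_abs_coeff_regZeta (hA : A.AxiomASharp c q η) :
    Summable fun n => |PowerSeries.coeff n (A.regZeta q)| := by
  obtain ⟨C, hC⟩ := hA.exists_abs_coeff_regZeta_le
  exact ((summable_geometric_of_lt_one hA.rpow_pos.le hA.rpow_lt_one).mul_left C).of_nonneg_of_le
      (fun _ => abs_nonneg _) hC

theorem AxiomASharp.summable_nat_mul_abs_coeff_regZeta (hA : A.AxiomASharp c q η) :
    Summable fun n : ℕ => (n : ℝ) * |PowerSeries.coeff n (A.regZeta q)| := by
  obtain ⟨C, hC⟩ := hA.exists_abs_coeff_regZeta_le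
  have h := (summable_pow_mul_geometric_of_norm_lt_one 1 (r := q ^ (η - 1))
    (by rw [Real.norm_eq_abs, abs_of_pos hA.rpow_pos]; exact hA.rpow_lt_one)).mul_left C
  refine h.of_nonneg_of_le (fun n => by positivity) fun n => ?_
  rw [pow_one, mul_left_comm]
  exact mul_le_mul_of_nonneg_left (hC n) n.cast_nonneg

theorem AxiomASharp.evalC_regZeta_one (hA : A.AxiomASharp c q η) :
    PowerSeries.evalC (A.regZeta q) 1 = c := by
  have h1 : HasSum (fun n => PowerSeries.coeff n (A.regZeta q)) c := by
    refine (hA.summable_abs_coeff_regZeta.of_abs.hasSum_iff_tendsto_nat).2 ?_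
    rw [← tendsto_add_atTop_iff_nat 1]
    refine hA.tendsto_coeff_zeta.congr fun n => ?_
    rw [regZeta, PowerSeries.sum_coeff_one_sub_X_mul]
  rw [PowerSeries.evalC, ← h1.tsum_eq, Complex.ofReal_tsum]
  simp

theorem abs_coeff_freeSeries_le (hq : 0 < q) (F : Finset A.primes) (n : ℕ) :
    |PowerSeries.coeff n (A.freeSeries q F)| ≤ PowerSeries.coeff n (A.zetaSeries q) := by
  classical
  rw [freeSeries, zetaSeries, coeff_genFun, coeff_genFun]
  refine (Finset.abs_sum_le_sum_abs _ _).trans (Finset.sum_le_sum fun g _ => ?_)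
  rw [abs_div, abs_of_pos (pow_pos hq _)]
  gcongr
  split_ifs <;> simp

theorem abs_coeff_moebiusSeries_le (hq : 0 < q) (F : Finset A.primes) (n : ℕ) :
    |PowerSeries.coeff n (A.moebiusSeries q F)| ≤ PowerSeries.coeff n (A.zetaSeries q) := by
  classical
  rw [moebiusSeries, zetaSeries, coeff_genFun, coeff_genFun]
  refine (Finset.abs_sum_le_sum_abs _ _).trans (Finset.sum_le_sum fun g _ => ?_)
  rw [abs_div, abs_of_pos (pow_pos hq _)]
  gcongr
  split_ifs
  · exact A.abs_moebius_le_one g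
  · simp

/-! ### The Euler product inside the disc of convergence -/

theorem coeff_degMonomial (q : ℝ) (r : G) (n : ℕ) :
    PowerSeries.coeff n (A.degMonomial q r) = if n = A.deg r then (q ^ A.deg r)⁻¹ else 0 := by
  rw [degMonomial, PowerSeries.coeff_C_mul, PowerSeries.coeff_X_pow]
  split_ifs <;> simp

theorem abs_coeff_degMonomial_le (hq : 0 < q) (r : G) (n : ℕ) :
    |PowerSeries.coeff n (A.degMonomial q r)| ≤ (q ^ A.deg r)⁻¹ := by
  have : 0 < (q ^ A.deg r)⁻¹ := by positivity
  rw [coeff_degMonomial]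
  split_ifs
  · rw [abs_of_pos this]
  · simpa using this.le

theorem evalC_degMonomial (q : ℝ) (r : G) (z : ℂ) :
    PowerSeries.evalC (A.degMonomial q r) z = (z / q) ^ A.deg r := by
  rw [PowerSeries.evalC, tsum_eq_single (A.deg r)]
  · rw [coeff_degMonomial, if_pos rfl, div_pow]
    push_cast
    rw [div_eq_mul_inv, mul_comm]
  · intro n hn
    rw [coeff_degMonomial, if_neg hn]
    simp

theorem evalC_freeSeries {B : ℝ} (hq : 0 < q)
    (hB : ∀ n, PowerSeries.coeff n (A.zetaSeries q) ≤ B) {z : ℂ} (hz : ‖z‖ < 1)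
    (F : Finset A.primes) :
    PowerSeries.evalC (A.freeSeries q F) z =
      PowerSeries.evalC (A.zetaSeries q) z * ∏ P ∈ F, (1 - (z / q) ^ A.deg (P : G)) := by
  classical
  have hb : ∀ F : Finset A.primes, ∀ n, |PowerSeries.coeff n (A.freeSeries q F)| ≤ B :=
    fun F n => (abs_coeff_freeSeries_le hq F n).trans (hB n)
  induction F using Finset.induction_on with
  | empty => simp [freeSeries_empty]
  | insert P F hP ih =>
    have hx : ∀ n, |PowerSeries.coeff n (A.degMonomial q (P : G) * A.freeSeries q F)| ≤
        B / q ^ A.deg (P : G) := by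
      intro n
      have hB0 : 0 ≤ B := (abs_nonneg _).trans (hb ∅ 0)
      rw [coeff_degMonomial_mul]
      split_ifs
      · rw [abs_div, abs_of_pos (pow_pos hq _)]
        gcongr
        exact hb F _
      · rw [abs_zero]; positivity
    rw [freeSeries_insert A q hP, Finset.prod_insert hP, mul_sub, mul_one,
      mul_comm (A.freeSeries q F), PowerSeries.evalC_sub (hb F) hx hz,
      PowerSeries.evalC_mul (abs_coeff_degMonomial_le hq _) (hb F) hz, evalC_degMonomial, ih]
    ring

theorem primesLE_mono : Monotone A.primesLE := by
  intro m n hmn P hP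
  rw [mem_primesLE] at hP ⊢
  exact hP.trans hmn

theorem tendsto_primesLE : Tendsto A.primesLE atTop atTop :=
  tendsto_atTop_finset_of_monotone primesLE_mono fun P =>
    ⟨A.deg (P : G), by simp⟩

theorem evalC_zeta_mul_moebius {B : ℝ} (hq : 0 < q)
    (hB : ∀ n, PowerSeries.coeff n (A.zetaSeries q) ≤ B) {z : ℂ} (hz : ‖z‖ < 1) :
    PowerSeries.evalC (A.moebiusSeries q ∅) z * PowerSeries.evalC (A.zetaSeries q) z = 1 := by
  rw [← PowerSeries.evalC_mul (fun n => (abs_coeff_moebiusSeries_le hq ∅ n).trans (hB n))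
    (fun n => by rw [abs_of_nonneg (coeff_zetaSeries_nonneg hq n)]; exact hB n) hz,
    moebiusSeries_mul_zetaSeries, PowerSeries.evalC_one]

theorem tendsto_prod_primesLE {B : ℝ} (hq : 0 < q)
    (hB : ∀ n, PowerSeries.coeff n (A.zetaSeries q) ≤ B) {z : ℂ} (hz : ‖z‖ < 1) :
    Tendsto (fun k => ∏ P ∈ A.primesLE k, (1 - (z / q) ^ A.deg (P : G))) atTop
      (𝓝 (PowerSeries.evalC (A.zetaSeries q) z)⁻¹) := by
  have hne := right_ne_zero_of_mul ((evalC_zeta_mul_moebius hq hB hz).symm ▸ one_ne_zero)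
  have h1 : Tendsto (fun k => PowerSeries.evalC (A.freeSeries q (A.primesLE k)) z) atTop
      (𝓝 (PowerSeries.evalC 1 z)) := by
    refine tendsto_tsum_of_dominated_convergence (bound := fun n => B * ‖z‖ ^ n)
      ((summable_geometric_of_lt_one (norm_nonneg z) hz).mul_left B) ?_ ?_
    · intro n
      refine tendsto_const_nhds.congr' ?_
      filter_upwards [eventually_ge_atTop n] with k hk
      rw [A.coeff_freeSeries q subset_rfl hk, PowerSeries.coeff_one]
    · refine Eventually.of_forall fun k n => ?_
      rw [norm_mul, norm_pow, Complex.norm_real, Real.norm_eq_abs]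
      gcongr
      exact (abs_coeff_freeSeries_le hq _ n).trans (hB n)
  rw [PowerSeries.evalC_one] at h1
  have h2 := h1.const_mul (PowerSeries.evalC (A.zetaSeries q) z)⁻¹
  rw [mul_one] at h2
  refine h2.congr fun k => ?_
  rw [evalC_freeSeries hq hB hz, inv_mul_cancel_left₀ hne]

theorem IsZetaFunction.eq_evalC {Z : ℂ → ℂ} (hZ : A.IsZetaFunction q η Z) {B : ℝ} (hq : 0 < q)
    (hB : ∀ n, PowerSeries.coeff n (A.zetaSeries q) ≤ B) {z : ℂ} (hz : ‖z‖ < 1) :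
    Z (z / q) = PowerSeries.evalC (A.zetaSeries q) z := by
  have h1 := (hZ.eulerProduct (z / q) (by
    rw [norm_div, Complex.norm_real, Real.norm_eq_abs, abs_of_pos hq, div_eq_mul_inv]
    exact mul_lt_of_lt_one_left (by positivity) hz)).comp tendsto_primesLE
  have hne := right_ne_zero_of_mul ((evalC_zeta_mul_moebius hq hB hz).symm ▸ one_ne_zero)
  have h2 := (tendsto_prod_primesLE hq hB hz).inv₀ (inv_ne_zero hne)
  rw [inv_inv] at h2
  refine tendsto_nhds_unique h1 (h2.congr fun k => ?_)
  simp [Finset.prod_inv_distrib]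

/-- The 3-4-1 inequality, obtained from the finite Euler products in the limit. -/
theorem one_le_norm_zeta_product {B : ℝ} (hq : 1 < q)
    (hB : ∀ n, PowerSeries.coeff n (A.zetaSeries q) ≤ B) {r : ℝ} (hr : 0 ≤ r) (hr1 : r < 1)
    {w : ℂ} (hw : ‖w‖ = 1) :
    1 ≤ ‖PowerSeries.evalC (A.zetaSeries q) r‖ ^ 3 *
      ‖PowerSeries.evalC (A.zetaSeries q) (r * w)‖ ^ 4 *
      ‖PowerSeries.evalC (A.zetaSeries q) (r * w ^ 2)‖ := by
  have hq0 : 0 < q := zero_lt_one.trans hq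
  have hn0 : ‖(r : ℂ)‖ < 1 := by rwa [Complex.norm_real, Real.norm_eq_abs, abs_of_nonneg hr]
  have hn1 : ‖(r : ℂ) * w‖ < 1 := by rwa [norm_mul, hw, mul_one]
  have hn2 : ‖(r : ℂ) * w ^ 2‖ < 1 := by rwa [norm_mul, norm_pow, hw, one_pow, mul_one]
  have hlim := (((tendsto_prod_primesLE hq0 hB hn0).norm.pow 3).mul
    ((tendsto_prod_primesLE hq0 hB hn1).norm.pow 4)).mul (tendsto_prod_primesLE hq0 hB hn2).norm
  have hle := le_of_tendsto (b := 1) hlim (Eventually.of_forall fun k => by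
    simp only [norm_prod, ← Finset.prod_pow, ← Finset.prod_mul_distrib]
    refine Finset.prod_le_one (fun _ _ => by positivity) fun P _ => ?_
    have hd := A.deg_pos P P.2
    have ha : (r / q) ^ A.deg (P : G) < 1 := by
      refine pow_lt_one₀ (by positivity) ?_ hd.ne'
      rw [div_lt_one hq0]
      linarith
    have := norm_euler_factor_product_le_one (a := (r / q) ^ A.deg (P : G)) (by positivity) ha
      (z := w ^ A.deg (P : G)) (by rw [norm_pow, hw, one_pow])
    have e0 : ((r : ℂ) / q) ^ A.deg (P : G) = ((r / q) ^ A.deg (P : G) : ℝ) := by push_cast; rfl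
    have e1 : ((r : ℂ) * w / q) ^ A.deg (P : G) =
        ((r / q) ^ A.deg (P : G) : ℝ) * w ^ A.deg (P : G) := by
      rw [← e0, ← mul_pow]; congr 1; ring
    have e2 : ((r : ℂ) * w ^ 2 / q) ^ A.deg (P : G) =
        ((r / q) ^ A.deg (P : G) : ℝ) * (w ^ A.deg (P : G)) ^ 2 := by
      rw [← e0, ← pow_mul, mul_comm _ 2, pow_mul, ← mul_pow]; congr 1; ring
    rw [e0, e1, e2]
    exact this)
  have hpos : ∀ z : ℂ, ‖z‖ < 1 → 0 < ‖PowerSeries.evalC (A.zetaSeries q) z‖ := fun z hz =>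
    norm_pos_iff.2 (right_ne_zero_of_mul ((evalC_zeta_mul_moebius hq0 hB hz).symm ▸ one_ne_zero))
  have h0 := hpos _ hn0
  have h1 := hpos _ hn1
  have h2 := hpos _ hn2
  simp only [norm_inv, inv_pow, ← mul_inv] at hle
  exact (inv_le_one₀ (by positivity)).1 hle

theorem AxiomASharp.evalC_regZeta (hA : A.AxiomASharp c q η) {z : ℂ} (hz : ‖z‖ < 1) :
    PowerSeries.evalC (A.regZeta q) z = (1 - z) * PowerSeries.evalC (A.zetaSeries q) z := by
  obtain ⟨B, hB⟩ := hA.exists_coeff_zeta_le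
  have hB' : ∀ n, |PowerSeries.coeff n (A.zetaSeries q)| ≤ B := fun n => by
    rw [abs_of_nonneg (coeff_zetaSeries_nonneg hA.q_pos n)]; exact hB n
  have hX : ∀ n, |PowerSeries.coeff n (1 - PowerSeries.X : PowerSeries ℝ)| ≤ 1 := by
    intro n
    rw [map_sub, PowerSeries.coeff_one, PowerSeries.coeff_X]
    split_ifs with h1 h2
    · omega
    all_goals simp
  have hX' : PowerSeries.evalC (1 - PowerSeries.X : PowerSeries ℝ) z = 1 - z := by
    rw [PowerSeries.evalC, tsum_eq_sum (s := Finset.range 2), Finset.sum_range_succ,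
      Finset.sum_range_one]
    swap
    · intro n hn
      rw [Finset.mem_range] at hn
      rw [map_sub, PowerSeries.coeff_one, PowerSeries.coeff_X, if_neg (by omega),
        if_neg (by omega)]
      simp
    simp [PowerSeries.coeff_X, PowerSeries.coeff_one]
    ring
  rw [regZeta, PowerSeries.evalC_mul hX hB' hz, hX']

end AdditiveArithmeticalSemigroup

namespace AdditiveArithmeticalSemigroup

variable {G : Type*} [AddCommMonoid G] {A : AdditiveArithmeticalSemigroup G} {c q η : ℝ}

/-! ### Non-vanishing on the closed unit disc -/

/-- The zeta function has no zero at `-1` in the normalized variable, by uniqueness of the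
holomorphic continuation. The identity theorem is applied on the part of the disc to the left of the pole, which is
convex. -/
theorem AxiomASharp.evalC_regZeta_neg_one_ne_zero (hA : A.AxiomASharp c q η) {Z : ℂ → ℂ}
    (hZ : A.IsZetaFunction q η Z) (hZ0 : Z (-(q : ℂ)⁻¹) ≠ 0) :
    PowerSeries.evalC (A.regZeta q) (-1) ≠ 0 := by
  have hq := hA.q_pos
  have hρ := hA.rpow_pos
  obtain ⟨B, hB⟩ := hA.exists_coeff_zeta_le
  obtain ⟨C, hC⟩ := hA.exists_abs_coeff_regZeta_le
  obtain ⟨r, hr1, hrρ⟩ : ∃ r : ℝ, 1 < r ∧ r < (q ^ (η - 1))⁻¹ :=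
    exists_between (one_lt_inv_iff₀.2 ⟨hρ, hA.rpow_lt_one⟩)
  have hρr : q ^ (η - 1) * r < 1 := by
    have := mul_lt_mul_of_pos_left hrρ hρ
    rwa [mul_inv_cancel₀ hρ.ne'] at this
  have hd1 : DifferentiableOn ℂ (PowerSeries.evalC (A.regZeta q)) (Metric.ball 0 r) := by
    have := PowerSeries.differentiableOn_tsum_coeff
      (K := (A.regZeta q).map Complex.ofRealHom) hρ (by linarith) hρr
      (fun n => by simpa using hC n)
    simpa [PowerSeries.evalC] using! this
  set U : Set ℂ := Metric.ball 0 r ∩ {z | z.re < 1} with hU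
  have hUo : IsOpen U := Metric.isOpen_ball.inter (isOpen_lt Complex.continuous_re continuous_const)
  have hUc : Convex ℝ U := (convex_ball 0 r).inter (convex_halfSpace_re_lt 1)
  have hd2 : DifferentiableOn ℂ (fun z : ℂ => (1 - z) * Z (z / q)) U := by
    refine (by fun_prop : DifferentiableOn ℂ (fun z : ℂ => 1 - z) U).mul ?_
    refine hZ.holomorphic.comp (by fun_prop) fun z hz => ⟨?_, ?_⟩
    · have hz1 := mem_ball_zero_iff.1 hz.1
      rw [mem_ball_zero_iff, norm_div, Complex.norm_real, Real.norm_eq_abs, abs_of_pos hq,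
        div_lt_iff₀ hq, ← Real.rpow_add_one hq.ne']
      rw [← Real.rpow_neg hq.le] at hrρ
      refine hz1.trans (hrρ.trans_eq ?_)
      congr 1; ring
    · intro h
      have hqc : (q : ℂ) ≠ 0 := by exact_mod_cast hq.ne'
      rw [Set.mem_singleton_iff, div_eq_mul_inv, mul_eq_right₀ (inv_ne_zero hqc)] at h
      have := hz.2
      rw [h] at this
      simp at this
  have h0 : (0 : ℂ) ∈ U := ⟨by simp; linarith, by simp⟩
  have h1 : (-1 : ℂ) ∈ U := ⟨by simpa using hr1, by simp⟩
  have heq : PowerSeries.evalC (A.regZeta q) =ᶠ[𝓝 0] fun z : ℂ => (1 - z) * Z (z / q) := by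
    filter_upwards [Metric.ball_mem_nhds (0 : ℂ) one_pos] with z hz
    rw [mem_ball_zero_iff] at hz
    rw [hA.evalC_regZeta hz, hZ.eq_evalC hq hB hz]
  have := ((hd1.mono Set.inter_subset_left).analyticOnNhd hUo).eqOn_of_preconnected_of_eventuallyEq
    (hd2.analyticOnNhd hUo) hUc.isPreconnected h0 heq h1
  rw [this]
  refine mul_ne_zero (by norm_num) ?_
  rwa [neg_div, one_div]

/-- The classical 3-4-1 argument: a zero at `w` with `|w| = 1` would force `w ^ 2` to be the pole
`1`. -/
theorem AxiomASharp.evalC_regZeta_ne_zero_of_sq_ne_one (hA : A.AxiomASharp c q η) {w : ℂ}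
    (hw : ‖w‖ = 1) (hw2 : w ^ 2 ≠ 1) : PowerSeries.evalC (A.regZeta q) w ≠ 0 := by
  intro h0
  obtain ⟨B, hB⟩ := hA.exists_coeff_zeta_le
  set K := A.regZeta q with hK
  set M := ∑' n, |PowerSeries.coeff n K|
  set M' := ∑' n : ℕ, (n : ℝ) * |PowerSeries.coeff n K|
  have hs : Summable fun n => |PowerSeries.coeff n K| := hA.summable_abs_coeff_regZeta
  have hs' := hA.summable_nat_mul_abs_coeff_regZeta
  have hM : 0 ≤ M := tsum_nonneg fun _ => abs_nonneg _
  have hM' : 0 ≤ M' := tsum_nonneg fun _ => by positivity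
  have key : ∀ r : ℝ, 0 ≤ r → r < 1 →
      ‖1 - (r : ℂ) * w‖ ^ 4 * ‖1 - (r : ℂ) * w ^ 2‖ ≤ M ^ 3 * M' ^ 4 * M * (1 - r) := by
    intro r hr hr1
    have hn0 : ‖(r : ℂ)‖ < 1 := by rwa [Complex.norm_real, Real.norm_eq_abs, abs_of_nonneg hr]
    have hn1 : ‖(r : ℂ) * w‖ < 1 := by rwa [norm_mul, hw, mul_one]
    have hn2 : ‖(r : ℂ) * w ^ 2‖ < 1 := by rwa [norm_mul, norm_pow, hw, one_pow, mul_one]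
    have h1 := one_le_norm_zeta_product (A := A) hA.one_lt_q hB hr hr1 hw
    have hr' : 0 < 1 - r := by linarith
    have e0 : ‖1 - (r : ℂ)‖ = 1 - r := by
      rw [← Complex.ofReal_one, ← Complex.ofReal_sub, Complex.norm_real, Real.norm_eq_abs,
        abs_of_pos hr']
    have h2 : (1 - r) ^ 3 * (‖1 - (r : ℂ) * w‖ ^ 4 * ‖1 - (r : ℂ) * w ^ 2‖) ≤
        ‖PowerSeries.evalC K r‖ ^ 3 * ‖PowerSeries.evalC K (r * w)‖ ^ 4 *
          ‖PowerSeries.evalC K (r * w ^ 2)‖ := by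
      rw [hK, hA.evalC_regZeta hn0, hA.evalC_regZeta hn1, hA.evalC_regZeta hn2, norm_mul, norm_mul,
        norm_mul, e0]
      have := mul_le_mul_of_nonneg_left h1
        (by positivity : 0 ≤ (1 - r) ^ 3 * (‖1 - (r : ℂ) * w‖ ^ 4 * ‖1 - (r : ℂ) * w ^ 2‖))
      rw [mul_one] at this
      refine this.trans_eq ?_
      ring
    have h3 : ‖PowerSeries.evalC K (r * w)‖ ≤ (1 - r) * M' := by
      have := PowerSeries.norm_evalC_sub_le hs hs' hr hr1.le hw
      rwa [h0, sub_zero] at this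
    have h4 : (1 - r) ^ 3 * (‖1 - (r : ℂ) * w‖ ^ 4 * ‖1 - (r : ℂ) * w ^ 2‖) ≤
        M ^ 3 * ((1 - r) * M') ^ 4 * M := by
      refine h2.trans ?_
      gcongr
      · exact PowerSeries.norm_evalC_le hs hn0.le
      · exact PowerSeries.norm_evalC_le hs hn2.le
    refine le_of_mul_le_mul_left (h4.trans_eq ?_) (pow_pos hr' 3)
    ring
  -- Letting `r → 1` in `key` contradicts `w ≠ 1` and `w ^ 2 ≠ 1`.
  have hcont1 : ContinuousAt
      (fun r : ℝ => ‖1 - (r : ℂ) * w‖ ^ 4 * ‖1 - (r : ℂ) * w ^ 2‖) 1 := by fun_prop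
  have hcont2 : ContinuousAt (fun r : ℝ => M ^ 3 * M' ^ 4 * M * (1 - r)) 1 := by fun_prop
  have hlim := le_of_tendsto_of_tendsto (hcont1.tendsto.mono_left nhdsWithin_le_nhds)
    (hcont2.tendsto.mono_left (nhdsWithin_le_nhds (s := Set.Iio 1))) (by
      filter_upwards [Ioo_mem_nhdsLT (zero_lt_one : (0 : ℝ) < 1)] with r hr
      exact key r hr.1.le hr.2)
  rw [sub_self, mul_zero, Complex.ofReal_one, one_mul, one_mul] at hlim
  have hw1 : w ≠ 1 := fun h => hw2 (by rw [h, one_pow])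
  have p1 : 0 < ‖1 - w‖ := norm_pos_iff.2 (sub_ne_zero.2 hw1.symm)
  have p2 : 0 < ‖1 - w ^ 2‖ := norm_pos_iff.2 (sub_ne_zero.2 hw2.symm)
  have : 0 < ‖1 - w‖ ^ 4 * ‖1 - w ^ 2‖ := by positivity
  linarith

theorem AxiomASharp.evalC_regZeta_ne_zero (hA : A.AxiomASharp c q η) {Z : ℂ → ℂ}
    (hZ : A.IsZetaFunction q η Z) (hZ0 : Z (-(q : ℂ)⁻¹) ≠ 0) {z : ℂ} (hz : ‖z‖ ≤ 1) :
    PowerSeries.evalC (A.regZeta q) z ≠ 0 := by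
  rcases hz.lt_or_eq with hz | hz
  · obtain ⟨B, hB⟩ := hA.exists_coeff_zeta_le
    rw [hA.evalC_regZeta hz]
    refine mul_ne_zero (sub_ne_zero.2 ?_)
      (right_ne_zero_of_mul ((evalC_zeta_mul_moebius hA.q_pos hB hz).symm ▸ one_ne_zero))
    rintro rfl
    simp at hz
  · by_cases h2 : z ^ 2 = 1
    · rcases eq_or_eq_neg_of_sq_eq_sq z 1 (by rw [h2, one_pow]) with rfl | rfl
      · rw [hA.evalC_regZeta_one]
        exact_mod_cast hA.c_pos.ne'
      · exact hA.evalC_regZeta_neg_one_ne_zero hZ hZ0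
    · exact hA.evalC_regZeta_ne_zero_of_sq_ne_one hz h2

theorem constantCoeff_regZeta (A : AdditiveArithmeticalSemigroup G) (q : ℝ) :
    PowerSeries.constantCoeff (A.regZeta q) = 1 := by
  have h1 : PowerSeries.coeff 0 (A.zetaSeries q) = 1 := by
    rw [coeff_zetaSeries, pow_zero, div_one, ← card_degEq]
    have : A.degEq 0 = {0} := by
      ext g
      rw [mem_degEq, Finset.mem_singleton]
      exact ⟨A.eq_zero_of_deg_eq_zero, fun h => by rw [h, map_zero]⟩
    simp [this]
  rw [regZeta, ← PowerSeries.coeff_zero_eq_constantCoeff_apply,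
    PowerSeries.coeff_zero_one_sub_X_mul, h1]

/-- The coefficients of `1 / ((1 - X) ζ)`, that is, the partial sums of `∑ μ(g) / ‖g‖` ordered by
degree, are absolutely summable. This carries the strength of the prime number theorem. -/
theorem AxiomASharp.summable_abs_coeff_inv_regZeta (hA : A.AxiomASharp c q η) {Z : ℂ → ℂ}
    (hZ : A.IsZetaFunction q η Z) (hZ0 : Z (-(q : ℂ)⁻¹) ≠ 0) :
    Summable fun n => |PowerSeries.coeff n (A.regZeta q)⁻¹| := by
  obtain ⟨C, hC⟩ := hA.exists_abs_coeff_regZeta_le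
  have h := PowerSeries.summable_norm_coeff_inv (K := (A.regZeta q).map Complex.ofRealHom)
    hA.rpow_pos hA.rpow_lt_one (fun n => by simpa using hC n) (fun z hz => by
      simpa [PowerSeries.evalC] using hA.evalC_regZeta_ne_zero hZ hZ0 hz)
  have e : ((A.regZeta q).map Complex.ofRealHom)⁻¹ =
      ((A.regZeta q)⁻¹).map Complex.ofRealHom := by
    rw [PowerSeries.inv_eq_iff_mul_eq_one (by
      rw [← PowerSeries.coeff_zero_eq_constantCoeff_apply, PowerSeries.coeff_map,
        PowerSeries.coeff_zero_eq_constantCoeff_apply, constantCoeff_regZeta]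
      simp), ← map_mul,
      PowerSeries.inv_mul_cancel _ (by rw [constantCoeff_regZeta]; exact one_ne_zero), map_one]
  rw [e] at h
  simpa using h

end AdditiveArithmeticalSemigroup

namespace PowerSeries

theorem abs_coeff_mul_le {Φ Ψ : PowerSeries ℝ} {B : ℝ} (hΦ : Summable fun n => |coeff n Φ|)
    (hΨ : ∀ n, |coeff n Ψ| ≤ B) (n : ℕ) :
    |coeff n (Φ * Ψ)| ≤ (∑' i, |coeff i Φ|) * B := by
  have hB : 0 ≤ B := (abs_nonneg _).trans (hΨ 0)
  rw [coeff_mul, Finset.Nat.sum_antidiagonal_eq_sum_range_succ_mk]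
  calc |∑ i ∈ Finset.range n.succ, coeff i Φ * coeff (n - i) Ψ|
      ≤ ∑ i ∈ Finset.range n.succ, |coeff i Φ| * B := by
        refine (Finset.abs_sum_le_sum_abs _ _).trans (Finset.sum_le_sum fun i _ => ?_)
        rw [abs_mul]
        gcongr
        exact hΨ _
    _ ≤ (∑' i, |coeff i Φ|) * B := by
        rw [← Finset.sum_mul]
        gcongr
        exact hΦ.sum_le_tsum _ fun _ _ => abs_nonneg _

theorem coeff_mul_nonneg {Φ Ψ : PowerSeries ℝ} (hΦ : ∀ n, 0 ≤ coeff n Φ)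
    (hΨ : ∀ n, 0 ≤ coeff n Ψ) (n : ℕ) : 0 ≤ coeff n (Φ * Ψ) := by
  rw [coeff_mul]
  exact Finset.sum_nonneg fun p _ => mul_nonneg (hΦ _) (hΨ _)

theorem summable_abs_coeff_mul {Φ Ψ : PowerSeries ℝ} (hΦ : Summable fun n => |coeff n Φ|)
    (hΨ : Summable fun n => |coeff n Ψ|) : Summable fun n => |coeff n (Φ * Ψ)| := by
  simpa only [coeff_mul, Real.norm_eq_abs] using
    summable_norm_sum_mul_antidiagonal_of_summable_norm (f := fun n => coeff n Φ)
      (g := fun n => coeff n Ψ) hΦ hΨ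

theorem coeff_X_mul_derivative {R : Type*} [CommSemiring R] (Φ : PowerSeries R) (n : ℕ) :
    coeff n (X * d⁄dX R Φ) = n * coeff n Φ := by
  cases n with
  | zero => simp
  | succ n => rw [coeff_succ_X_mul, coeff_derivative]; push_cast; ring

end PowerSeries

namespace AdditiveArithmeticalSemigroup

variable {G : Type*} [AddCommMonoid G] (A : AdditiveArithmeticalSemigroup G) {c q η : ℝ}

/-! ### Partial Euler products -/

/-- The Euler factor `(1 - (X / q) ^ ∂r)⁻¹`, as a geometric series. -/
noncomputable def eulerFactor (q : ℝ) (r : G) : PowerSeries ℝ :=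
  PowerSeries.mk fun n => if A.deg r ∣ n then (q ^ n)⁻¹ else 0

/-- The partial Euler product `∏ P ∈ F, (1 - (X / q) ^ ∂P)⁻¹`. -/
noncomputable def eulerProd (q : ℝ) (F : Finset A.primes) : PowerSeries ℝ :=
  ∏ P ∈ F, A.eulerFactor q (P : G)

theorem eulerFactor_mul (q : ℝ) {r : G} (hr : 0 < A.deg r) :
    A.eulerFactor q r * (1 - A.degMonomial q r) = 1 := by
  ext n
  rw [mul_sub, mul_one, mul_comm _ (A.degMonomial q r), map_sub, coeff_degMonomial_mul,
    eulerFactor, PowerSeries.coeff_mk, PowerSeries.coeff_mk, PowerSeries.coeff_one]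
  by_cases hn : A.deg r ≤ n
  · rw [if_pos hn, if_neg (by omega : n ≠ 0)]
    by_cases hd : A.deg r ∣ n
    · rw [if_pos hd, if_pos (Nat.dvd_sub hd dvd_rfl), ← one_div, ← one_div, div_div, ← pow_add,
        Nat.sub_add_cancel hn, sub_self]
    · rw [if_neg hd, if_neg, zero_div, sub_zero]
      intro h
      have := Nat.dvd_add h (dvd_refl _)
      rw [Nat.sub_add_cancel hn] at this
      exact hd this
  · rw [if_neg hn, sub_zero]
    by_cases h0 : n = 0
    · simp [h0]
    · rw [if_neg h0, if_neg (fun h => hn (Nat.le_of_dvd (by omega) h))]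

theorem coeff_eulerFactor_nonneg (hq : 0 < q) (r : G) (n : ℕ) :
    0 ≤ PowerSeries.coeff n (A.eulerFactor q r) := by
  rw [eulerFactor, PowerSeries.coeff_mk]
  split_ifs <;> positivity

theorem summable_abs_coeff_eulerFactor (hq : 1 < q) (r : G) :
    Summable fun n => |PowerSeries.coeff n (A.eulerFactor q r)| := by
  have hq0 : 0 < q := zero_lt_one.trans hq
  refine (summable_geometric_of_lt_one (inv_nonneg.2 hq0.le)
    (inv_lt_one_of_one_lt₀ hq)).of_nonneg_of_le (fun _ => abs_nonneg _) fun n => ?_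
  rw [eulerFactor, PowerSeries.coeff_mk, inv_pow]
  have : 0 < (q ^ n)⁻¹ := by positivity
  split_ifs
  · rw [abs_of_pos this]
  · simpa using this.le

theorem eulerProd_mul_eulerDenom (q : ℝ) (F : Finset A.primes) :
    A.eulerProd q F * A.eulerDenom q F = 1 := by
  rw [eulerProd, eulerDenom, ← Finset.prod_mul_distrib]
  exact Finset.prod_eq_one fun P _ => A.eulerFactor_mul q (A.deg_pos P P.2)

open Classical in
theorem eulerProd_insert (q : ℝ) {P : A.primes} {F : Finset A.primes} (hP : P ∉ F) :
    A.eulerProd q (insert P F) =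
      A.eulerProd q F + A.degMonomial q (P : G) * A.eulerProd q (insert P F) := by
  rw [eulerProd, Finset.prod_insert hP, ← eulerProd]
  linear_combination A.eulerProd q F * A.eulerFactor_mul q (A.deg_pos P P.2)

theorem coeff_eulerProd_nonneg (hq : 0 < q) (F : Finset A.primes) :
    ∀ n, 0 ≤ PowerSeries.coeff n (A.eulerProd q F) := by
  classical
  induction F using Finset.induction_on with
  | empty =>
    intro n
    rw [eulerProd, Finset.prod_empty, PowerSeries.coeff_one]
    split_ifs <;> simp
  | insert P F hP ih =>
    rw [eulerProd, Finset.prod_insert hP]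
    exact PowerSeries.coeff_mul_nonneg (A.coeff_eulerFactor_nonneg hq _) ih

theorem summable_abs_coeff_eulerProd (hq : 1 < q) (F : Finset A.primes) :
    Summable fun n => |PowerSeries.coeff n (A.eulerProd q F)| := by
  classical
  induction F using Finset.induction_on with
  | empty =>
    refine summable_of_ne_finset_zero (s := {0}) fun n hn => ?_
    rw [Finset.mem_singleton] at hn
    rw [eulerProd, Finset.prod_empty, PowerSeries.coeff_one, if_neg hn, abs_zero]
  | insert P F hP ih =>
    rw [eulerProd, Finset.prod_insert hP]
    exact PowerSeries.summable_abs_coeff_mul (A.summable_abs_coeff_eulerFactor hq _) ih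

/-- Partial Euler products are dominated coefficientwise by the zeta function, since
`ζ = Y_F * U_F` where `U_F` has non-negative coefficients and constant coefficient `1`. -/
theorem coeff_eulerProd_le (hq : 0 < q) (F : Finset A.primes) (n : ℕ) :
    PowerSeries.coeff n (A.eulerProd q F) ≤ PowerSeries.coeff n (A.zetaSeries q) := by
  classical
  have h1 : A.zetaSeries q = A.eulerProd q F * A.freeSeries q F := by
    rw [freeSeries_eq]
    linear_combination - A.zetaSeries q * A.eulerProd_mul_eulerDenom q F
  have h2 : ∀ i, 0 ≤ PowerSeries.coeff i (A.freeSeries q F) := by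
    intro i
    rw [freeSeries, coeff_genFun]
    refine Finset.sum_nonneg fun g _ => div_nonneg ?_ (by positivity)
    split_ifs <;> simp
  have h3 : PowerSeries.coeff 0 (A.freeSeries q F) = 1 := by
    have h4 : A.primesLE 0 ⊆ F := fun P hP => by
      have := A.deg_pos P P.2
      rw [mem_primesLE] at hP
      omega
    rw [A.coeff_freeSeries q h4 le_rfl, if_pos rfl]
  rw [h1, PowerSeries.coeff_mul]
  refine le_trans ?_ (Finset.single_le_sum (a := (n, 0))
    (fun p _ => mul_nonneg (A.coeff_eulerProd_nonneg hq F p.1) (h2 p.2)) (by simp))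
  rw [h3, mul_one]

/-- `(1 - X)⁻¹ ∑ μ(g) (X / q) ^ ∂g`, the sum being over the elements `g` without prime factors in
`F`. Its `n`-th coefficient is `∑ μ(g) / ‖g‖` over those `g` of degree at most `n`. -/
noncomputable def roughSeries (q : ℝ) (F : Finset A.primes) : PowerSeries ℝ :=
  (A.regZeta q)⁻¹ * A.eulerProd q F

theorem one_sub_X_mul_inv_regZeta (q : ℝ) :
    (1 - PowerSeries.X) * (A.regZeta q)⁻¹ = A.moebiusSeries q ∅ := by
  have h1 := A.moebiusSeries_mul_zetaSeries q
  have h2 := PowerSeries.mul_inv_cancel (A.regZeta q)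
    (by rw [constantCoeff_regZeta]; exact one_ne_zero)
  rw [regZeta] at h2 ⊢
  linear_combination (-((1 - PowerSeries.X) * ((1 - PowerSeries.X) * A.zetaSeries q)⁻¹)) * h1 +
    A.moebiusSeries q ∅ * h2

/-- Dividing `∑ μ(g) (X / q) ^ ∂g = 1 / ζ` by the Euler factors of `F` in `1 / ζ` leaves the
elements without prime factors in `F`. -/
theorem one_sub_X_mul_roughSeries (q : ℝ) (F : Finset A.primes) :
    (1 - PowerSeries.X) * A.roughSeries q F = A.moebiusSeries q F := by
  rw [roughSeries, ← mul_assoc, one_sub_X_mul_inv_regZeta, A.moebiusSeries_empty_eq q F]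
  linear_combination A.moebiusSeries q F * A.eulerProd_mul_eulerDenom q F

open Classical in
theorem coeff_roughSeries (q : ℝ) (F : Finset A.primes) (n : ℕ) :
    PowerSeries.coeff n (A.roughSeries q F) =
      ∑ g ∈ A.degLE n, (if A.IsFreeOf F g then (A.moebius g : ℝ) else 0) / q ^ A.deg g := by
  rw [sum_degLE_eq_sum_coeff_genFun, ← PowerSeries.sum_coeff_one_sub_X_mul,
    A.one_sub_X_mul_roughSeries q, moebiusSeries]

/-! ### A Chebyshev bound -/

/-- The finite set of primes of degree `n`. -/
noncomputable def primesEq (n : ℕ) : Finset A.primes :=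
  (A.primesLE n).filter fun P => A.deg (P : G) = n

@[simp] theorem mem_primesEq {n : ℕ} {P : A.primes} : P ∈ A.primesEq n ↔ A.deg (P : G) = n := by
  rw [primesEq, Finset.mem_filter, mem_primesLE]
  omega

theorem X_mul_derivative_degMonomial (q : ℝ) (r : G) :
    PowerSeries.X * PowerSeries.derivative ℝ (A.degMonomial q r) =
      (A.deg r : PowerSeries ℝ) * A.degMonomial q r := by
  ext n
  rw [PowerSeries.coeff_X_mul_derivative, ← nsmul_eq_mul (A.deg r), map_nsmul, coeff_degMonomial,
    nsmul_eq_mul]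
  split_ifs with h
  · rw [h]
  · simp

/-- The logarithmic derivative of a partial Euler product. -/
noncomputable def logDerivSeries (q : ℝ) (F : Finset A.primes) : PowerSeries ℝ :=
  ∑ P ∈ F, (A.deg (P : G) : PowerSeries ℝ) * (A.degMonomial q (P : G) * A.eulerFactor q (P : G))

theorem X_mul_derivative_eulerDenom (q : ℝ) (F : Finset A.primes) :
    PowerSeries.X * PowerSeries.derivative ℝ (A.eulerDenom q F) =
      - (A.eulerDenom q F * A.logDerivSeries q F) := by
  classical
  induction F using Finset.induction_on with
  | empty => simp [eulerDenom, logDerivSeries]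
  | insert P F hP ih =>
    have h1 := A.X_mul_derivative_degMonomial q (P : G)
    have h2 := A.eulerFactor_mul q (A.deg_pos P P.2)
    rw [eulerDenom, Finset.prod_insert hP, ← eulerDenom, Derivation.leibniz, smul_eq_mul,
      smul_eq_mul, map_sub, Derivation.map_one_eq_zero, zero_sub, logDerivSeries,
      Finset.sum_insert hP, ← logDerivSeries]
    linear_combination (1 - A.degMonomial q (P : G)) * ih - A.eulerDenom q F * h1 +
      A.eulerDenom q F * (A.deg (P : G) : PowerSeries ℝ) * A.degMonomial q (P : G) * h2

/-- The logarithmic derivative of the zeta function agrees with that of the Euler product over the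
primes of degree at most `n` up to the `n`-th coefficient. -/
theorem coeff_logDerivSeries (q : ℝ) (n : ℕ) :
    PowerSeries.coeff n (A.logDerivSeries q (A.primesLE n)) =
      PowerSeries.coeff n (A.moebiusSeries q ∅ *
        (PowerSeries.X * PowerSeries.derivative ℝ (A.zetaSeries q))) := by
  set F := A.primesLE n
  have hU := A.freeSeries_eq q F
  have hD := A.X_mul_derivative_eulerDenom q F
  have hY := A.eulerProd_mul_eulerDenom q F
  have hL := A.moebiusSeries_mul_zetaSeries q
  have h1 : A.moebiusSeries q ∅ * (PowerSeries.X * PowerSeries.derivative ℝ (A.zetaSeries q)) =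
      A.logDerivSeries q F + A.moebiusSeries q ∅ * A.eulerProd q F *
        (PowerSeries.X * PowerSeries.derivative ℝ (A.freeSeries q F)) := by
    rw [hU, Derivation.leibniz, smul_eq_mul, smul_eq_mul]
    linear_combination (-(A.moebiusSeries q ∅ *
        (PowerSeries.X * PowerSeries.derivative ℝ (A.zetaSeries q))) +
        A.moebiusSeries q ∅ * A.zetaSeries q * A.logDerivSeries q F) * hY +
      A.logDerivSeries q F * hL -
      A.moebiusSeries q ∅ * A.eulerProd q F * A.zetaSeries q * hD
  rw [h1, map_add, left_eq_add, PowerSeries.coeff_mul]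
  refine Finset.sum_eq_zero fun p hp => ?_
  have hp' := Finset.HasAntidiagonal.mem_antidiagonal.1 hp
  rw [PowerSeries.coeff_X_mul_derivative, A.coeff_freeSeries q subset_rfl (by omega)]
  split_ifs with h <;> simp [h]

theorem coeff_zero_eulerFactor (q : ℝ) (r : G) :
    PowerSeries.coeff 0 (A.eulerFactor q r) = 1 := by
  simp [eulerFactor]

theorem nat_mul_card_primesEq_le (hq : 0 < q) (n : ℕ) :
    n * ((A.primesEq n).card / q ^ n) ≤
      PowerSeries.coeff n (A.logDerivSeries q (A.primesLE n)) := by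
  rw [logDerivSeries, map_sum]
  have hterm : ∀ P : A.primes, PowerSeries.coeff n ((A.deg (P : G) : PowerSeries ℝ) *
      (A.degMonomial q (P : G) * A.eulerFactor q (P : G))) = A.deg (P : G) *
        (if A.deg (P : G) ≤ n then
          PowerSeries.coeff (n - A.deg (P : G)) (A.eulerFactor q (P : G)) / q ^ A.deg (P : G)
        else 0) := by
    intro P
    rw [← nsmul_eq_mul, map_nsmul, nsmul_eq_mul, coeff_degMonomial_mul]
  calc n * ((A.primesEq n).card / q ^ n)
      = ∑ P ∈ A.primesEq n, PowerSeries.coeff n ((A.deg (P : G) : PowerSeries ℝ) *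
          (A.degMonomial q (P : G) * A.eulerFactor q (P : G))) := by
        rw [Finset.sum_congr rfl (g := fun _ => (n : ℝ) * (1 / q ^ n)), Finset.sum_const,
          nsmul_eq_mul]
        · ring
        · intro P hP
          rw [hterm, A.mem_primesEq.1 hP, if_pos le_rfl, Nat.sub_self, coeff_zero_eulerFactor]
    _ ≤ _ := by
        refine Finset.sum_le_sum_of_subset_of_nonneg (Finset.filter_subset _ _) fun P _ _ => ?_
        rw [hterm]
        refine mul_nonneg (Nat.cast_nonneg _) ?_
        split_ifs
        · exact div_nonneg (A.coeff_eulerFactor_nonneg hq _ _) (by positivity)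
        · exact le_rfl

variable {A} in
/-- Chebyshev's upper bound `#{P : ∂P = n} = O(q ^ n / n)`. The logarithmic derivative of
`ζ = K / (1 - X)` is `X / (1 - X) + X K' / K`, and the coefficients of the second term are bounded
because those of `1 / K` and `X K'` are summable. -/
theorem AxiomASharp.exists_card_primesEq_le (hA : A.AxiomASharp c q η)
    (hs : Summable fun n => |PowerSeries.coeff n (A.regZeta q)⁻¹|) :
    ∃ C : ℝ, ∀ n : ℕ, n * ((A.primesEq n).card / q ^ n) ≤ C := by
  have hθ : ∀ n, |PowerSeries.coeff n
      (PowerSeries.X * PowerSeries.derivative ℝ (A.regZeta q))| ≤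
      ∑' n : ℕ, (n : ℝ) * |PowerSeries.coeff n (A.regZeta q)| := by
    intro n
    rw [PowerSeries.coeff_X_mul_derivative, abs_mul, Nat.abs_cast]
    exact hA.summable_nat_mul_abs_coeff_regZeta.le_tsum n fun _ _ => by positivity
  have hsplit : A.moebiusSeries q ∅ *
      (PowerSeries.X * PowerSeries.derivative ℝ (A.zetaSeries q)) =
      (A.regZeta q)⁻¹ * (PowerSeries.X * PowerSeries.derivative ℝ (A.regZeta q)) +
        PowerSeries.X * PowerSeries.mk 1 := by
    have h1 := A.one_sub_X_mul_inv_regZeta q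
    have h2 := PowerSeries.mul_inv_cancel (A.regZeta q)
      (by rw [constantCoeff_regZeta]; exact one_ne_zero)
    have h3 := PowerSeries.mk_one_mul_one_sub_eq_one ℝ
    have h4 : A.zetaSeries q * (A.regZeta q)⁻¹ = PowerSeries.mk 1 := by
      have e : A.regZeta q = (1 - PowerSeries.X) * A.zetaSeries q := rfl
      linear_combination (-(A.zetaSeries q * (A.regZeta q)⁻¹)) * h3 +
        PowerSeries.mk 1 * h2 - PowerSeries.mk 1 * (A.regZeta q)⁻¹ * e
    have h5 : PowerSeries.derivative ℝ (A.regZeta q) =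
        (1 - PowerSeries.X) * PowerSeries.derivative ℝ (A.zetaSeries q) - A.zetaSeries q := by
      rw [regZeta, Derivation.leibniz, map_sub, Derivation.map_one_eq_zero,
        PowerSeries.derivative_X, smul_eq_mul, smul_eq_mul]
      ring
    rw [h5, ← h1, ← h4]
    ring
  refine ⟨(∑' i, |PowerSeries.coeff i (A.regZeta q)⁻¹|) *
    (∑' n : ℕ, (n : ℝ) * |PowerSeries.coeff n (A.regZeta q)|) + 1, fun n => ?_⟩
  refine (A.nat_mul_card_primesEq_le hA.q_pos n).trans ?_
  rw [A.coeff_logDerivSeries q, hsplit, map_add]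
  refine add_le_add ((le_abs_self _).trans (PowerSeries.abs_coeff_mul_le hs hθ n)) ?_
  cases n with
  | zero => simp
  | succ n => simp [PowerSeries.coeff_succ_X_mul]

end AdditiveArithmeticalSemigroup

/-- A Toeplitz lemma: averaging a null sequence against uniformly summable weights, each of which
tends to `0`, gives a null sequence. -/
theorem tendsto_sum_mul_of_tendsto_zero {ε : ℕ → ℝ} {w : ℕ → ℕ → ℝ} {C : ℝ}
    (hε : Tendsto ε atTop (𝓝 0)) (hw : ∀ n, ∑ k ∈ Finset.range n, |w n k| ≤ C)
    (hw0 : ∀ k, Tendsto (fun n => w n k) atTop (𝓝 0)) :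
    Tendsto (fun n => ∑ k ∈ Finset.range n, ε k * w n k) atTop (𝓝 0) := by
  have hC : 0 ≤ C := by simpa using hw 0
  rw [Metric.tendsto_atTop]
  intro e he
  obtain ⟨N, hN⟩ := (Metric.tendsto_atTop.1 hε) (e / (2 * (C + 1))) (by positivity)
  have h1 : Tendsto (fun n => ∑ k ∈ Finset.range N, |ε k| * |w n k|) atTop (𝓝 0) := by
    have := tendsto_finsetSum (Finset.range N) fun k _ => ((hw0 k).abs.const_mul |ε k|)
    simpa using this
  obtain ⟨M, hM⟩ := (Metric.tendsto_atTop.1 h1) (e / 2) (by positivity)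
  refine ⟨max M N, fun n hn => ?_⟩
  have hnM := hM n (le_of_max_le_left hn)
  have hnN : N ≤ n := le_of_max_le_right hn
  rw [Real.dist_eq, sub_zero] at hnM ⊢
  have hnM' := (le_abs_self _).trans_lt hnM
  have htail : ∑ k ∈ Finset.Ico N n, |ε k| * |w n k| ≤ e / (2 * (C + 1)) * C := by
    calc ∑ k ∈ Finset.Ico N n, |ε k| * |w n k|
        ≤ ∑ k ∈ Finset.Ico N n, e / (2 * (C + 1)) * |w n k| := by
          refine Finset.sum_le_sum fun k hk => ?_
          have := hN k (Finset.mem_Ico.1 hk).1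
          rw [Real.dist_eq, sub_zero] at this
          gcongr
      _ ≤ e / (2 * (C + 1)) * C := by
          rw [← Finset.mul_sum]
          gcongr
          refine le_trans ?_ (hw n)
          refine Finset.sum_le_sum_of_subset_of_nonneg (fun k hk => ?_) fun _ _ _ => abs_nonneg _
          exact Finset.mem_range.2 (Finset.mem_Ico.1 hk).2
  have hhalf : e / (2 * (C + 1)) * C < e / 2 := by
    rw [div_mul_eq_mul_div, div_lt_div_iff₀ (by positivity) (by positivity)]
    nlinarith
  calc |∑ k ∈ Finset.range n, ε k * w n k| ≤ ∑ k ∈ Finset.range n, |ε k| * |w n k| := by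
        refine (Finset.abs_sum_le_sum_abs _ _).trans_eq ?_
        simp only [abs_mul]
    _ = ∑ k ∈ Finset.range N, |ε k| * |w n k| + ∑ k ∈ Finset.Ico N n, |ε k| * |w n k| :=
        (Finset.sum_range_add_sum_Ico _ hnN).symm
    _ < e := by linarith

namespace AdditiveArithmeticalSemigroup

variable {G : Type*} [AddCommMonoid G] (A : AdditiveArithmeticalSemigroup G) {c q η : ℝ}

/-! ### Telescoping over the degree of the smallest prime -/

theorem abs_coeff_degMonomial_mul_le (hq : 0 < q) {Φ : PowerSeries ℝ} {B : ℝ}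
    (hΦ : ∀ n, |PowerSeries.coeff n Φ| ≤ B) (r : G) (n : ℕ) :
    |PowerSeries.coeff n (A.degMonomial q r * Φ)| ≤ B / q ^ A.deg r := by
  have hB : 0 ≤ B := (abs_nonneg _).trans (hΦ 0)
  rw [coeff_degMonomial_mul]
  split_ifs
  · rw [abs_div, abs_of_pos (pow_pos hq _)]
    gcongr
    exact hΦ _
  · rw [abs_zero]; positivity

open Classical in
/-- Adjoining to `F` a set `T` of primes of the same degree `k` changes the partial Euler product
`Y` by `∑ P ∈ T, (X / q) ^ k * Y_{F ∪ T}` up to an error quadratic in `#T / q ^ k`, because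
adjoining a single prime changes it by exactly `(X / q) ^ k * Y_{F ∪ {P}}`. -/
theorem abs_coeff_eulerProd_union_sub_le (hq : 0 < q) {Φ : PowerSeries ℝ} {B : ℝ}
    (hΦ : ∀ F : Finset A.primes, ∀ n, |PowerSeries.coeff n (Φ * A.eulerProd q F)| ≤ B) {k : ℕ}
    (F T : Finset A.primes) (hFT : Disjoint F T) (hT : ∀ P ∈ T, A.deg (P : G) = k) (n : ℕ) :
    |PowerSeries.coeff n (Φ * A.eulerProd q (F ∪ T) - Φ * A.eulerProd q F -
      ∑ P ∈ T, A.degMonomial q (P : G) * (Φ * A.eulerProd q (F ∪ T)))| ≤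
      B * (T.card / q ^ k) ^ 2 := by
  have hB : 0 ≤ B := (abs_nonneg _).trans (hΦ ∅ 0)
  induction T using Finset.induction_on with
  | empty => simp
  | insert P T hP ih =>
    have hFT' : Disjoint F T := hFT.mono_right (Finset.subset_insert _ _)
    have hPF : P ∉ F ∪ T := by
      rw [Finset.mem_union, not_or]
      exact ⟨fun h => Finset.disjoint_left.1 hFT h (Finset.mem_insert_self _ _), hP⟩
    have hPk := hT P (Finset.mem_insert_self _ _)
    have hTk : ∀ Q ∈ T, A.deg (Q : G) = k := fun Q hQ => hT Q (Finset.mem_insert_of_mem hQ)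
    have hY := A.eulerProd_insert q hPF
    have ih' := ih hFT' hTk
    rw [Finset.union_insert, Finset.sum_insert hP]
    set Y' := A.eulerProd q (insert P (F ∪ T)) with hY'
    set Y := A.eulerProd q (F ∪ T)
    have hcross : ∀ Q ∈ T, |PowerSeries.coeff n (A.degMonomial q (Q : G) *
        (A.degMonomial q (P : G) * (Φ * Y')))| ≤ B / q ^ k / q ^ k := by
      intro Q hQ
      have h1 : ∀ m, |PowerSeries.coeff m (A.degMonomial q (P : G) * (Φ * Y'))| ≤ B / q ^ k :=
        fun m => by
          have := A.abs_coeff_degMonomial_mul_le hq (hΦ (insert P (F ∪ T))) (P : G) m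
          rwa [hPk] at this
      have := A.abs_coeff_degMonomial_mul_le hq h1 (Q : G) n
      rwa [hTk Q hQ] at this
    have e : Φ * Y' - Φ * A.eulerProd q F - (A.degMonomial q (P : G) * (Φ * Y') +
        ∑ Q ∈ T, A.degMonomial q (Q : G) * (Φ * Y')) =
        (Φ * Y - Φ * A.eulerProd q F - ∑ Q ∈ T, A.degMonomial q (Q : G) * (Φ * Y)) -
          ∑ Q ∈ T, A.degMonomial q (Q : G) * (A.degMonomial q (P : G) * (Φ * Y')) := by
      simp only [← Finset.sum_mul]
      linear_combination Φ * (1 - ∑ Q ∈ T, A.degMonomial q (Q : G)) * hY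
    rw [e, map_sub, map_sum]
    calc _ ≤ B * (T.card / q ^ k) ^ 2 + T.card * (B / q ^ k / q ^ k) := by
          refine (abs_sub _ _).trans (add_le_add ih' ?_)
          refine (Finset.abs_sum_le_sum_abs _ _).trans ?_
          rw [← nsmul_eq_mul]
          exact Finset.sum_le_card_nsmul _ _ _ hcross
      _ ≤ _ := by
          rw [Finset.card_insert_of_notMem hP]
          push_cast
          have h1 : ∀ t x : ℝ, B * ((t + 1) / x) ^ 2 =
              B * (t / x) ^ 2 + t * (B / x / x) + (t + 1) * (B / x / x) := by
            intro t x
            ring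
          have h2 : 0 ≤ ((T.card : ℝ) + 1) * (B / q ^ k / q ^ k) :=
            mul_nonneg (add_nonneg (Nat.cast_nonneg _) zero_le_one)
              (div_nonneg (div_nonneg hB (pow_pos hq k).le)
              (pow_pos hq k).le)
          rw [h1]
          linarith

theorem primesLE_zero : A.primesLE 0 = ∅ := by
  ext P
  have := A.deg_pos P P.2
  simp only [mem_primesLE, Finset.notMem_empty, iff_false]
  omega

theorem disjoint_primesLE_primesEq (k : ℕ) : Disjoint (A.primesLE k) (A.primesEq (k + 1)) := by
  rw [Finset.disjoint_left]
  intro P hP hP'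
  rw [mem_primesLE] at hP
  rw [mem_primesEq] at hP'
  omega

open Classical in
theorem primesLE_succ (k : ℕ) : A.primesLE (k + 1) = A.primesLE k ∪ A.primesEq (k + 1) := by
  ext P
  simp only [Finset.mem_union, mem_primesLE, mem_primesEq]
  omega

theorem sum_primesLE {M : Type*} [AddCommMonoid M] (f : A.primes → M) (n : ℕ) :
    ∑ P ∈ A.primesLE n, f P = ∑ k ∈ Finset.range n, ∑ P ∈ A.primesEq (k + 1), f P := by
  classical
  induction n with
  | zero => simp [primesLE_zero]
  | succ n ih =>
    rw [Finset.sum_range_succ, primesLE_succ, Finset.sum_union (A.disjoint_primesLE_primesEq n), ih]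

/-- The part of the telescoping sum belonging to a prime `P`. For `Φ = 1 / ((1 - X) ζ)` its
coefficients are, up to sign, the sums of `μ(g) / ‖g‖` over the `g` with smallest prime `P`. -/
noncomputable def minPrimeSeries (q : ℝ) (Φ : PowerSeries ℝ) (P : A.primes) : PowerSeries ℝ :=
  A.degMonomial q (P : G) * (Φ * A.eulerProd q (A.primesLE (A.deg (P : G))))

/-- The error of one step in the telescoping. -/
noncomputable def telescopeError (q : ℝ) (Φ : PowerSeries ℝ) (n k : ℕ) : ℝ :=
  PowerSeries.coeff n (Φ * A.eulerProd q (A.primesLE (k + 1))) -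
    PowerSeries.coeff n (Φ * A.eulerProd q (A.primesLE k)) -
    ∑ P ∈ A.primesEq (k + 1), PowerSeries.coeff n (A.minPrimeSeries q Φ P)

theorem sum_coeff_minPrimeSeries (q : ℝ) (Φ : PowerSeries ℝ) (n m : ℕ) :
    ∑ P ∈ A.primesLE m, PowerSeries.coeff n (A.minPrimeSeries q Φ P) =
      PowerSeries.coeff n (Φ * A.eulerProd q (A.primesLE m)) - PowerSeries.coeff n Φ -
        ∑ k ∈ Finset.range m, A.telescopeError q Φ n k := by
  simp only [telescopeError]
  rw [sum_primesLE, Finset.sum_sub_distrib, Finset.sum_range_sub (fun k =>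
    PowerSeries.coeff n (Φ * A.eulerProd q (A.primesLE k)))]
  simp [primesLE_zero, eulerProd]

theorem abs_telescopeError_le (hq : 0 < q) {Φ : PowerSeries ℝ} {B C : ℝ}
    (hΦ : ∀ F : Finset A.primes, ∀ n, |PowerSeries.coeff n (Φ * A.eulerProd q F)| ≤ B)
    (hC : ∀ n : ℕ, n * ((A.primesEq n).card / q ^ n) ≤ C) (n k : ℕ) :
    |A.telescopeError q Φ n k| ≤ B * C ^ 2 * (1 / ((k + 1 : ℕ) : ℝ) ^ 2) := by
  classical
  have hB : 0 ≤ B := (abs_nonneg _).trans (hΦ ∅ 0)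
  have h := A.abs_coeff_eulerProd_union_sub_le hq hΦ (A.primesLE k) (A.primesEq (k + 1))
    (A.disjoint_primesLE_primesEq k) (fun P hP => A.mem_primesEq.1 hP) n
  rw [← primesLE_succ, map_sub, map_sub, map_sum] at h
  have e : ∑ P ∈ A.primesEq (k + 1), PowerSeries.coeff n (A.degMonomial q (P : G) *
      (Φ * A.eulerProd q (A.primesLE (k + 1)))) =
      ∑ P ∈ A.primesEq (k + 1), PowerSeries.coeff n (A.minPrimeSeries q Φ P) :=
    Finset.sum_congr rfl fun P hP => by rw [minPrimeSeries, A.mem_primesEq.1 hP]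
  rw [e] at h
  refine h.trans ?_
  have h1 := hC (k + 1)
  have h2 : ((A.primesEq (k + 1)).card : ℝ) / q ^ (k + 1) ≤ C / ((k + 1 : ℕ) : ℝ) := by
    rw [le_div_iff₀ (by positivity), mul_comm]
    exact h1
  calc B * (((A.primesEq (k + 1)).card : ℝ) / q ^ (k + 1)) ^ 2
      ≤ B * (C / ((k + 1 : ℕ) : ℝ)) ^ 2 := by gcongr
    _ = _ := by rw [div_pow]; ring

theorem summable_one_div_succ_sq : Summable fun k : ℕ => 1 / ((k + 1 : ℕ) : ℝ) ^ 2 :=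
  (summable_nat_add_iff 1).2 (Real.summable_one_div_nat_pow.2 one_lt_two)

variable {A}

theorem abs_coeff_eulerProd_le {B : ℝ} (hq : 0 < q)
    (hB : ∀ n, PowerSeries.coeff n (A.zetaSeries q) ≤ B) (F : Finset A.primes) (n : ℕ) :
    |PowerSeries.coeff n (A.eulerProd q F)| ≤ B := by
  rw [abs_of_nonneg (A.coeff_eulerProd_nonneg hq F n)]
  exact (A.coeff_eulerProd_le hq F n).trans (hB n)

theorem coeff_minPrimeSeries_one_nonneg (hq : 0 < q) (P : A.primes) (n : ℕ) :
    0 ≤ PowerSeries.coeff n (A.minPrimeSeries q 1 P) := by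
  rw [minPrimeSeries, one_mul, coeff_degMonomial_mul]
  split_ifs
  · exact div_nonneg (A.coeff_eulerProd_nonneg hq _ _) (by positivity)
  · exact le_rfl

/-- The total contribution of all primes is absolutely bounded. For `Φ = 1` all terms are
non-negative and the telescoping bounds their sum; multiplying by a series with absolutely summable
coefficients preserves the bound. -/
theorem AxiomASharp.exists_sum_abs_coeff_minPrimeSeries_le (hA : A.AxiomASharp c q η)
    (hs : Summable fun n => |PowerSeries.coeff n (A.regZeta q)⁻¹|) :
    ∃ C : ℝ, ∀ n m : ℕ, ∑ P ∈ A.primesLE m,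
      |PowerSeries.coeff n (A.minPrimeSeries q (A.regZeta q)⁻¹ P)| ≤ C := by
  obtain ⟨B, hB⟩ := hA.exists_coeff_zeta_le
  obtain ⟨C, hC⟩ := hA.exists_card_primesEq_le hs
  have hq := hA.q_pos
  have hΦ : ∀ F : Finset A.primes, ∀ n, |PowerSeries.coeff n (1 * A.eulerProd q F)| ≤ B :=
    fun F n => by rw [one_mul]; exact abs_coeff_eulerProd_le hq hB F n
  set T := B + B * C ^ 2 * ∑' k : ℕ, 1 / ((k + 1 : ℕ) : ℝ) ^ 2 with hT
  have h1 : ∀ n m, ∑ P ∈ A.primesLE m, PowerSeries.coeff n (A.minPrimeSeries q 1 P) ≤ T := by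
    intro n m
    have hB0 : 0 ≤ B := (abs_nonneg _).trans (hΦ ∅ 0)
    rw [sum_coeff_minPrimeSeries]
    have e1 := (abs_le.1 (hΦ (A.primesLE m) n)).2
    have e2 : 0 ≤ PowerSeries.coeff n (1 : PowerSeries ℝ) := by
      rw [PowerSeries.coeff_one]; split_ifs <;> simp
    have e3 : -∑ k ∈ Finset.range m, A.telescopeError q 1 n k ≤
        B * C ^ 2 * ∑' k : ℕ, 1 / ((k + 1 : ℕ) : ℝ) ^ 2 := by
      calc _ ≤ ∑ k ∈ Finset.range m, B * C ^ 2 * (1 / ((k + 1 : ℕ) : ℝ) ^ 2) := by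
            rw [← Finset.sum_neg_distrib]
            exact Finset.sum_le_sum fun k _ =>
              (neg_le_abs _).trans (A.abs_telescopeError_le hq hΦ hC n k)
        _ ≤ _ := by
            rw [← Finset.mul_sum]
            gcongr
            exact summable_one_div_succ_sq.sum_le_tsum _ fun _ _ => by positivity
    rw [hT]
    linarith
  refine ⟨(∑' i, |PowerSeries.coeff i (A.regZeta q)⁻¹|) * T, fun n m => ?_⟩
  have h2 : ∀ P : A.primes, |PowerSeries.coeff n (A.minPrimeSeries q (A.regZeta q)⁻¹ P)| ≤
      ∑ p ∈ Finset.HasAntidiagonal.antidiagonal n, |PowerSeries.coeff p.1 (A.regZeta q)⁻¹| *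
        PowerSeries.coeff p.2 (A.minPrimeSeries q 1 P) := by
    intro P
    have e : A.minPrimeSeries q (A.regZeta q)⁻¹ P =
        (A.regZeta q)⁻¹ * A.minPrimeSeries q 1 P := by
      rw [minPrimeSeries, minPrimeSeries]; ring
    rw [e, PowerSeries.coeff_mul]
    refine (Finset.abs_sum_le_sum_abs _ _).trans_eq (Finset.sum_congr rfl fun p _ => ?_)
    rw [abs_mul, abs_of_nonneg (coeff_minPrimeSeries_one_nonneg hq P _)]
  have hT0 : 0 ≤ T := by simpa [primesLE_zero] using h1 0 0
  calc _ ≤ ∑ P ∈ A.primesLE m, ∑ p ∈ Finset.HasAntidiagonal.antidiagonal n,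
        |PowerSeries.coeff p.1 (A.regZeta q)⁻¹| *
          PowerSeries.coeff p.2 (A.minPrimeSeries q 1 P) := Finset.sum_le_sum fun P _ => h2 P
    _ = ∑ p ∈ Finset.HasAntidiagonal.antidiagonal n, |PowerSeries.coeff p.1 (A.regZeta q)⁻¹| *
          ∑ P ∈ A.primesLE m, PowerSeries.coeff p.2 (A.minPrimeSeries q 1 P) := by
        rw [Finset.sum_comm]
        simp only [Finset.mul_sum]
    _ ≤ ∑ p ∈ Finset.HasAntidiagonal.antidiagonal n,
          |PowerSeries.coeff p.1 (A.regZeta q)⁻¹| * T :=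
        Finset.sum_le_sum fun p _ => mul_le_mul_of_nonneg_left (h1 _ _) (abs_nonneg _)
    _ ≤ _ := by
        rw [← Finset.sum_mul, Finset.Nat.sum_antidiagonal_eq_sum_range_succ_mk]
        gcongr
        exact hs.sum_le_tsum _ fun _ _ => abs_nonneg _

theorem AxiomASharp.exists_abs_coeff_roughSeries_le (hA : A.AxiomASharp c q η)
    (hs : Summable fun n => |PowerSeries.coeff n (A.regZeta q)⁻¹|) :
    ∃ B : ℝ, ∀ (F : Finset A.primes) (n : ℕ), |PowerSeries.coeff n (A.roughSeries q F)| ≤ B := by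
  obtain ⟨B, hB⟩ := hA.exists_coeff_zeta_le
  exact ⟨_, fun F n => PowerSeries.abs_coeff_mul_le hs
    (fun n => abs_coeff_eulerProd_le hA.q_pos hB F n) n⟩

theorem tendsto_coeff_roughSeries (hq : 1 < q)
    (hs : Summable fun n => |PowerSeries.coeff n (A.regZeta q)⁻¹|) (F : Finset A.primes) :
    Tendsto (fun n => PowerSeries.coeff n (A.roughSeries q F)) atTop (𝓝 0) :=
  (PowerSeries.summable_abs_coeff_mul hs
    (A.summable_abs_coeff_eulerProd hq F)).of_abs.tendsto_atTop_zero

theorem tendsto_coeff_minPrimeSeries (hq : 1 < q)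
    (hs : Summable fun n => |PowerSeries.coeff n (A.regZeta q)⁻¹|) (P : A.primes) :
    Tendsto (fun n => PowerSeries.coeff n (A.minPrimeSeries q (A.regZeta q)⁻¹ P)) atTop
      (𝓝 0) := by
  have h : Summable fun n => |PowerSeries.coeff n (A.degMonomial q (P : G))| := by
    refine summable_of_ne_finset_zero (s := {A.deg (P : G)}) fun n hn => ?_
    rw [Finset.mem_singleton] at hn
    rw [coeff_degMonomial, if_neg hn, abs_zero]
  exact (PowerSeries.summable_abs_coeff_mul h (PowerSeries.summable_abs_coeff_mul hs
    (A.summable_abs_coeff_eulerProd hq _))).of_abs.tendsto_atTop_zero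

theorem tendsto_telescopeError (hq : 1 < q)
    (hs : Summable fun n => |PowerSeries.coeff n (A.regZeta q)⁻¹|) (k : ℕ) :
    Tendsto (fun n => A.telescopeError q (A.regZeta q)⁻¹ n k) atTop (𝓝 0) := by
  have h := ((tendsto_coeff_roughSeries hq hs (A.primesLE (k + 1))).sub
    (tendsto_coeff_roughSeries hq hs (A.primesLE k))).sub
    (tendsto_finsetSum (A.primesEq (k + 1)) fun P _ => tendsto_coeff_minPrimeSeries hq hs P)
  simpa [telescopeError, roughSeries] using! h

theorem AxiomASharp.tendsto_sum_coeff_minPrimeSeries (hA : A.AxiomASharp c q η)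
    (hs : Summable fun n => |PowerSeries.coeff n (A.regZeta q)⁻¹|) :
    Tendsto (fun n => ∑ P ∈ A.primesLE n,
      PowerSeries.coeff n (A.minPrimeSeries q (A.regZeta q)⁻¹ P)) atTop (𝓝 1) := by
  obtain ⟨B, hB⟩ := hA.exists_abs_coeff_roughSeries_le hs
  obtain ⟨C, hC⟩ := hA.exists_card_primesEq_le hs
  -- The only element of degree at most `n` without prime factors of degree at most `n` is `0`.
  have h1 : ∀ n, PowerSeries.coeff n ((A.regZeta q)⁻¹ * A.eulerProd q (A.primesLE n)) = 1 := by
    intro n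
    change PowerSeries.coeff n (A.roughSeries q (A.primesLE n)) = 1
    rw [← PowerSeries.sum_coeff_one_sub_X_mul, one_sub_X_mul_roughSeries,
      Finset.sum_congr rfl (g := fun i => if i = 0 then (1 : ℝ) else 0)]
    · simp
    · intro i hi
      rw [Finset.mem_range] at hi
      exact A.coeff_moebiusSeries q subset_rfl (by omega)
  have h2 : Tendsto (fun n => ∑ k ∈ Finset.range n, A.telescopeError q (A.regZeta q)⁻¹ n k)
      atTop (𝓝 0) := by
    have h3 := tendsto_tsum_of_dominated_convergence (𝓕 := atTop)
      (f := fun n k => if k < n then A.telescopeError q (A.regZeta q)⁻¹ n k else 0)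
      (g := fun _ => (0 : ℝ)) (summable_one_div_succ_sq.mul_left (B * C ^ 2)) (fun k => by
        refine (tendsto_telescopeError hA.one_lt_q hs k).congr' ?_
        filter_upwards [eventually_gt_atTop k] with n hn
        rw [if_pos hn]) (Eventually.of_forall fun n k => by
          have h4 := A.abs_telescopeError_le hA.q_pos (Φ := (A.regZeta q)⁻¹) hB hC n k
          split_ifs
          · exact h4
          · rw [norm_zero]
            exact (abs_nonneg _).trans h4)
    rw [tsum_zero] at h3
    refine h3.congr fun n => ?_
    rw [tsum_eq_sum (s := Finset.range n) fun k hk => if_neg fun h => hk (Finset.mem_range.2 h)]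
    exact Finset.sum_congr rfl fun k hk => if_pos (Finset.mem_range.1 hk)
  have h4 := (tendsto_const_nhds (x := (1 : ℝ)).sub hs.of_abs.tendsto_atTop_zero).sub h2
  rw [sub_zero, sub_zero] at h4
  refine h4.congr fun n => ?_
  rw [sum_coeff_minPrimeSeries, h1]

open Classical in
theorem primeCount_eq_card {S : Set G} (hS : S ⊆ A.primes) (n : ℕ) :
    A.primeCount S n = ((A.primesEq n).filter fun (P : A.primes) => (P : G) ∈ S).card := by
  rw [primeCount, ← Finset.card_map (Function.Embedding.subtype _), ← Set.ncard_coe_finset]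
  congr 1
  ext P
  simp only [Set.mem_ofPred_eq, Finset.coe_map, Function.Embedding.subtype_apply, Set.mem_image,
    Finset.mem_coe, Finset.mem_filter, mem_primesEq, Subtype.exists, exists_and_right,
    exists_eq_right]
  exact ⟨fun h => ⟨⟨hS h.1, h.2⟩, h.1⟩, fun h => ⟨h.2, h.1.2⟩⟩

theorem coeff_minPrimeSeries_congr (q : ℝ) (Φ : PowerSeries ℝ) {P Q : A.primes}
    (h : A.deg (P : G) = A.deg (Q : G)) : A.minPrimeSeries q Φ P = A.minPrimeSeries q Φ Q := by
  rw [minPrimeSeries, minPrimeSeries, degMonomial, degMonomial, h]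

open Classical in
/-- Restricting the smallest prime to a set of natural density `δ` multiplies the limit by `δ`. -/
theorem AxiomASharp.tendsto_sum_filter_coeff_minPrimeSeries (hA : A.AxiomASharp c q η)
    (hs : Summable fun n => |PowerSeries.coeff n (A.regZeta q)⁻¹|) {S : Set G}
    (hS : S ⊆ A.primes) {δ : ℝ} (hδ : A.HasNaturalDensity S δ) :
    Tendsto (fun n => ∑ P ∈ (A.primesLE n).filter fun (P : A.primes) => (P : G) ∈ S,
      PowerSeries.coeff n (A.minPrimeSeries q (A.regZeta q)⁻¹ P)) atTop (𝓝 δ) := by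
  obtain ⟨C, hC⟩ := hA.exists_sum_abs_coeff_minPrimeSeries_le hs
  set v : ℕ → A.primes → ℝ :=
    fun n P => PowerSeries.coeff n (A.minPrimeSeries q (A.regZeta q)⁻¹ P) with hv
  set ratio : ℕ → ℝ := fun k => (A.primeCount S k : ℝ) / (A.primeCount A.primes k : ℝ)
  have hlayer : ∀ n k, ∑ P ∈ A.primesEq k, (if (P : G) ∈ S then v n P else 0) =
      ratio k * ∑ P ∈ A.primesEq k, v n P := by
    intro n k
    rw [← Finset.sum_filter]
    -- If there are no primes of degree `k`, then `ratio k = 0 / 0 = 0`, and both sides vanish.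
    rcases (A.primesEq k).eq_empty_or_nonempty with h0 | ⟨Q, hQ⟩
    · simp [h0]
    · have hconst : ∀ P ∈ A.primesEq k, v n P = v n Q := fun P hP => by
        simp only [hv]
        rw [coeff_minPrimeSeries_congr q _
          ((A.mem_primesEq.1 hP).trans (A.mem_primesEq.1 hQ).symm)]
      have hcard : A.primeCount A.primes k = (A.primesEq k).card := by
        rw [primeCount_eq_card subset_rfl, Finset.filter_true_of_mem fun (P : A.primes) _ => P.2]
      have hpos : 0 < ((A.primesEq k).card : ℝ) := by
        exact_mod_cast Finset.card_pos.2 ⟨Q, hQ⟩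
      rw [Finset.sum_congr rfl fun P hP => hconst P (Finset.mem_filter.1 hP).1,
        Finset.sum_congr rfl hconst, Finset.sum_const, Finset.sum_const, nsmul_eq_mul,
        nsmul_eq_mul]
      simp only [ratio]
      rw [primeCount_eq_card hS, hcard]
      field_simp
  have h1 := tendsto_sum_mul_of_tendsto_zero (C := C)
    (ε := fun k => ratio (k + 1) - δ) (w := fun n k => ∑ P ∈ A.primesEq (k + 1), v n P)
    (by
      have := (hδ.comp (tendsto_add_atTop_nat 1)).sub_const δ
      rwa [sub_self] at this)
    (fun n => by
      refine le_trans (Finset.sum_le_sum fun k _ => Finset.abs_sum_le_sum_abs _ _) ?_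
      rw [← sum_primesLE]
      exact hC n n)
    (fun k => by
      simpa using tendsto_finsetSum (A.primesEq (k + 1)) fun P _ =>
        tendsto_coeff_minPrimeSeries hA.one_lt_q hs P)
  have h2 := h1.add ((hA.tendsto_sum_coeff_minPrimeSeries hs).const_mul δ)
  rw [zero_add, mul_one] at h2
  refine h2.congr fun n => ?_
  rw [Finset.sum_filter, sum_primesLE, sum_primesLE, Finset.mul_sum, ← Finset.sum_add_distrib]
  refine Finset.sum_congr rfl fun k _ => ?_
  rw [hlayer n (k + 1)]
  ring

end AdditiveArithmeticalSemigroup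

namespace AdditiveArithmeticalSemigroup

variable {G : Type*} [AddCommMonoid G] (A : AdditiveArithmeticalSemigroup G) {c q η : ℝ}

/-! ### Elements with a unique smallest prime factor -/

/-- `P` is the only prime factor of `g` of minimal degree. -/
def IsUniqueMin (P : A.primes) (g : G) : Prop :=
  Divides (P : G) g ∧ ∀ Q : A.primes, Divides (Q : G) g → Q ≠ P → A.deg (P : G) < A.deg (Q : G)

variable {A}

theorem IsUniqueMin.unique {P Q : A.primes} {g : G} (hP : A.IsUniqueMin P g)
    (hQ : A.IsUniqueMin Q g) : P = Q := by
  by_contra h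
  have h1 := hP.2 Q hQ.1 (Ne.symm h)
  have h2 := hQ.2 P hP.1 h
  omega

theorem IsUniqueMin.ne_zero {P : A.primes} {g : G} (hP : A.IsUniqueMin P g) : g ≠ 0 := by
  rintro rfl
  exact A.not_prime_divides_zero P hP.1

theorem IsUniqueMin.isMinPrimeFactor {P : A.primes} {g : G} (hP : A.IsUniqueMin P g) :
    A.IsMinPrimeFactor P g := by
  refine ⟨⟨P.2, hP.1⟩, le_antisymm ?_ ?_⟩
  · refine le_csInf ⟨_, P, ⟨P.2, hP.1⟩, rfl⟩ ?_
    rintro _ ⟨Q, hQ, rfl⟩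
    by_cases h : (⟨Q, hQ.1⟩ : A.primes) = P
    · rw [← h]
    · exact (hP.2 ⟨Q, hQ.1⟩ hQ.2 h).le
  · exact Nat.sInf_le ⟨P, ⟨P.2, hP.1⟩, rfl⟩

/-- `0` lies in the distinguished set by convention and has to be excluded here. -/
theorem mem_distinguishedSet_iff {S : Set G} {g : G} (hg : g ≠ 0) :
    g ∈ A.distinguishedSet S ↔ ∃ P : A.primes, (P : G) ∈ S ∧ A.IsUniqueMin P g := by
  constructor
  · rintro (⟨⟨_, hu⟩, P, hPS, hP⟩ | h)
    · refine ⟨⟨P, hP.1.1⟩, hPS, hP.1.2, fun Q hQ hne => ?_⟩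
      have hle : A.minDeg g ≤ A.deg (Q : G) := Nat.sInf_le ⟨Q, ⟨Q.2, hQ⟩, rfl⟩
      refine lt_of_le_of_ne (hP.2.trans_le hle) fun h => hne (Subtype.ext ?_)
      exact hu.unique ⟨⟨Q.2, hQ⟩, h.symm.trans hP.2⟩ hP
    · exact absurd h hg
  · rintro ⟨P, hPS, hP⟩
    refine Or.inl ⟨⟨hg, P, hP.isMinPrimeFactor, fun Q hQ => ?_⟩, P, hPS, hP.isMinPrimeFactor⟩
    by_contra h
    have h1 := hP.2 ⟨Q, hQ.1.1⟩ hQ.1.2 (fun h' => h (congrArg Subtype.val h'))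
    have h2 := hQ.2.trans hP.isMinPrimeFactor.2.symm
    simp only at h1
    omega

theorem isUniqueMin_prime_add {P : A.primes} {h : G} (hd : ¬ Divides (P : G) h) :
    A.IsUniqueMin P (P + h) ↔ A.IsFreeOf (A.primesLE (A.deg (P : G))) h := by
  constructor
  · intro hm Q hQ hQh
    rw [mem_primesLE] at hQ
    have hne : Q ≠ P := by
      rintro rfl
      exact hd hQh
    have := hm.2 Q ((A.prime_divides_add_iff Q).2 (Or.inr hQh)) hne
    omega
  · intro hf
    refine ⟨⟨h, rfl⟩, fun Q hQ hne => ?_⟩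
    rcases (A.prime_divides_add_iff Q).1 hQ with h1 | h1
    · exact absurd ((A.prime_divides_prime_iff Q P).1 h1) hne
    · by_contra h2
      exact hf Q (A.mem_primesLE.2 (not_lt.1 h2)) h1

/-- The smallest prime of `h + r` is either that of `r` or a smaller one, coming from `h`. -/
theorem isUniqueMin_add_iff [DecidableEq A.primes] {P Q : A.primes} {r : G}
    (hQ : A.IsUniqueMin Q r) (h : G) :
    A.IsUniqueMin P (h + r) ↔
      (P = Q ∧ A.IsFreeOf ((A.primesLE (A.deg (Q : G))).erase Q) h) ∨
      (A.deg (P : G) < A.deg (Q : G) ∧ A.IsUniqueMin P h) := by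
  have hQhr : Divides (Q : G) (h + r) := (A.prime_divides_add_iff Q).2 (Or.inr hQ.1)
  constructor
  · intro hm
    by_cases hPQ : P = Q
    · subst hPQ
      refine Or.inl ⟨rfl, fun R hR hRh => ?_⟩
      rw [Finset.mem_erase, mem_primesLE] at hR
      have := hm.2 R ((A.prime_divides_add_iff R).2 (Or.inl hRh)) hR.1
      omega
    · have hlt := hm.2 Q hQhr (Ne.symm hPQ)
      refine Or.inr ⟨hlt, ?_, fun R hR hne =>
        hm.2 R ((A.prime_divides_add_iff R).2 (Or.inl hR)) hne⟩
      refine ((A.prime_divides_add_iff P).1 hm.1).resolve_right fun hPr => ?_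
      have := hQ.2 P hPr hPQ
      omega
  · rintro (⟨rfl, hf⟩ | ⟨hlt, hm⟩)
    · refine ⟨hQhr, fun R hR hne => ?_⟩
      rcases (A.prime_divides_add_iff R).1 hR with h1 | h1
      · by_contra h2
        exact hf R (Finset.mem_erase.2 ⟨hne, A.mem_primesLE.2 (not_lt.1 h2)⟩) h1
      · exact hQ.2 R h1 hne
    · refine ⟨(A.prime_divides_add_iff P).2 (Or.inl hm.1), fun R hR hne => ?_⟩
      rcases (A.prime_divides_add_iff R).1 hR with h1 | h1
      · exact hm.2 R h1 hne
      · by_cases hRQ : R = Q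
        · rwa [hRQ]
        · exact hlt.trans (hQ.2 R h1 hRQ)

open Classical in
theorem genFun_isUniqueMin (q : ℝ) (P : A.primes) :
    A.genFun q (fun g => if A.IsUniqueMin P g then (A.moebius g : ℝ) else 0) =
      - (A.degMonomial q (P : G) * A.moebiusSeries q (A.primesLE (A.deg (P : G)))) := by
  have h1 := A.genFun_ite_divides q (P : G)
    (fun g => if A.IsUniqueMin P g then (A.moebius g : ℝ) else 0)
  have h2 : (fun h => if A.IsUniqueMin P (P + h) then (A.moebius ((P : G) + h) : ℝ) else 0) =
      fun h => -(if A.IsFreeOf (A.primesLE (A.deg (P : G))) h then (A.moebius h : ℝ) else 0) := by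
    ext h
    by_cases hd : Divides (P : G) h
    · have h3 : ¬ A.IsFreeOf (A.primesLE (A.deg (P : G))) h := fun hf => hf P (by simp) hd
      rw [A.moebius_prime_add_of_divides P hd, if_neg h3]
      simp
    · rw [A.moebius_prime_add_of_not_divides P hd, isUniqueMin_prime_add hd]
      split_ifs <;> simp
  rw [h2, genFun_neg, ← moebiusSeries] at h1
  rw [← mul_neg, ← h1]
  congr 1
  ext g
  by_cases hm : A.IsUniqueMin P g
  · rw [if_pos hm.1]
  · simp [hm]

open Classical in
/-- Squarefree elements with unique smallest prime `P` are `P + h` with all prime factors of `h` of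
degree above `∂P`, and `μ(P + h) = -μ(h)`. -/
theorem sum_isUniqueMin_moebius (q : ℝ) (P : A.primes) (n : ℕ) :
    ∑ g ∈ A.degLE n, (if A.IsUniqueMin P g then (A.moebius g : ℝ) else 0) / q ^ A.deg g =
      - PowerSeries.coeff n (A.minPrimeSeries q (A.regZeta q)⁻¹ P) := by
  have h := A.one_sub_X_mul_roughSeries q (A.primesLE (A.deg (P : G)))
  have e : -(A.degMonomial q (P : G) * A.moebiusSeries q (A.primesLE (A.deg (P : G)))) =
      (1 - PowerSeries.X) * (-A.minPrimeSeries q (A.regZeta q)⁻¹ P) := by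
    rw [minPrimeSeries, ← roughSeries]
    linear_combination A.degMonomial q (P : G) * h
  rw [sum_degLE_eq_sum_coeff_genFun, genFun_isUniqueMin, e, PowerSeries.sum_coeff_one_sub_X_mul,
    map_neg]

variable (A)

open Classical in
/-- The sum of `μ(h) / ‖h‖` over those `h` of degree at most `n` for which `h + r` is a non-zero
element of the distinguished set. -/
noncomputable def shiftedSum (q : ℝ) (S : Set G) (r : G) (n : ℕ) : ℝ :=
  ∑ h ∈ A.degLE n, (if h + r ∈ A.distinguishedSet S ∧ h + r ≠ 0 then (A.moebius h : ℝ) else 0) /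
    q ^ A.deg h

variable {A}

open Classical in
theorem shiftedSum_zero (q : ℝ) (S : Set G) (n : ℕ) :
    A.shiftedSum q S 0 n = - ∑ P ∈ (A.primesLE n).filter fun (P : A.primes) => (P : G) ∈ S,
      PowerSeries.coeff n (A.minPrimeSeries q (A.regZeta q)⁻¹ P) := by
  simp only [← Finset.sum_neg_distrib, ← sum_isUniqueMin_moebius]
  rw [shiftedSum, Finset.sum_comm]
  refine Finset.sum_congr rfl fun g hg => ?_
  rw [← Finset.sum_div]
  congr 1
  rw [add_zero]
  by_cases h : ∃ P : A.primes, (P : G) ∈ S ∧ A.IsUniqueMin P g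
  · have h0 : g ≠ 0 := h.choose_spec.2.ne_zero
    rw [if_pos ⟨(mem_distinguishedSet_iff h0).2 h, h0⟩]
    obtain ⟨P, hPS, hP⟩ := h
    rw [Finset.sum_eq_single P, if_pos hP]
    · intro Q _ hne
      rw [if_neg fun hQ => hne (hQ.unique hP)]
    · intro hn
      refine absurd ?_ hn
      rw [Finset.mem_filter, mem_primesLE]
      exact ⟨(A.deg_le_of_divides hP.1).trans (A.mem_degLE.1 hg), hPS⟩
  · rw [if_neg fun hh => h ((mem_distinguishedSet_iff hh.2).1 hh.1), Finset.sum_eq_zero]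
    intro P hP
    rw [if_neg fun hm => h ⟨P, (Finset.mem_filter.1 hP).2, hm⟩]

open Classical in
/-- For `r` with unique smallest prime `Q`, the element `h + r` is distinguished with smallest prime
in `S` exactly if `h` has a unique smallest prime in `S` of degree below `∂Q`, or `h` has no prime
factor other than `Q` of degree at most `∂Q`. -/
theorem shiftedSum_eq (q : ℝ) {S : Set G} {Q : A.primes} (hQS : (Q : G) ∈ S) {r : G}
    (hQ : A.IsUniqueMin Q r) (n : ℕ) :
    A.shiftedSum q S r n =
      - ∑ P ∈ (A.primesLE (A.deg (Q : G) - 1)).filter fun (P : A.primes) => (P : G) ∈ S,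
          PowerSeries.coeff n (A.minPrimeSeries q (A.regZeta q)⁻¹ P) +
        PowerSeries.coeff n (A.roughSeries q ((A.primesLE (A.deg (Q : G))).erase Q)) := by
  have hQpos := A.deg_pos Q Q.2
  simp only [← Finset.sum_neg_distrib, ← sum_isUniqueMin_moebius]
  rw [shiftedSum, Finset.sum_comm, coeff_roughSeries, ← Finset.sum_add_distrib]
  refine Finset.sum_congr rfl fun h _ => ?_
  rw [← Finset.sum_div, ← add_div]
  congr 1
  have hQhr : Divides (Q : G) (h + r) := (A.prime_divides_add_iff Q).2 (Or.inr hQ.1)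
  have h0 : h + r ≠ 0 := by
    intro e
    rw [e] at hQhr
    exact A.not_prime_divides_zero Q hQhr
  have hmem : (h + r ∈ A.distinguishedSet S ∧ h + r ≠ 0) ↔
      A.IsFreeOf ((A.primesLE (A.deg (Q : G))).erase Q) h ∨
        ∃ P : A.primes, (P : G) ∈ S ∧ A.deg (P : G) < A.deg (Q : G) ∧ A.IsUniqueMin P h := by
    rw [and_iff_left h0, mem_distinguishedSet_iff h0]
    simp only [isUniqueMin_add_iff hQ]
    constructor
    · rintro ⟨P, hPS, ⟨-, hf⟩ | hP⟩
      · exact Or.inl hf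
      · exact Or.inr ⟨P, hPS, hP⟩
    · rintro (hf | ⟨P, hPS, hP⟩)
      · exact ⟨Q, hQS, Or.inl ⟨rfl, hf⟩⟩
      · exact ⟨P, hPS, Or.inr hP⟩
  rw [if_congr hmem rfl rfl]
  by_cases hex : ∃ P : A.primes, (P : G) ∈ S ∧ A.deg (P : G) < A.deg (Q : G) ∧ A.IsUniqueMin P h
  · rw [if_pos (Or.inr hex)]
    obtain ⟨P, hPS, hlt, hP⟩ := hex
    have hnf : ¬ A.IsFreeOf ((A.primesLE (A.deg (Q : G))).erase Q) h := fun hf =>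
      hf P (Finset.mem_erase.2 ⟨fun e => by rw [e] at hlt; exact lt_irrefl _ hlt,
        A.mem_primesLE.2 hlt.le⟩) hP.1
    rw [if_neg hnf, add_zero, Finset.sum_eq_single P, if_pos hP]
    · intro R _ hne
      rw [if_neg fun hR => hne (hR.unique hP)]
    · intro hn
      refine absurd ?_ hn
      rw [Finset.mem_filter, mem_primesLE]
      exact ⟨by omega, hPS⟩
  · rw [Finset.sum_eq_zero, zero_add]
    · simp only [hex, or_false]
    · intro P hP
      rw [Finset.mem_filter, mem_primesLE] at hP
      rw [if_neg fun hm => hex ⟨P, hP.2, by omega, hm⟩]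

theorem sum_distinguishedUpTo_moebius (q : ℝ) (S : Set G) (n : ℕ) :
    ∑ g ∈ A.distinguishedUpTo S n, (A.moebius g : ℝ) / q ^ A.deg g = A.shiftedSum q S 0 n := by
  classical
  rw [shiftedSum]
  simp only [ite_div, zero_div, ← Finset.sum_filter, add_zero]
  refine Finset.sum_congr ?_ fun _ _ => rfl
  ext g
  simp only [distinguishedUpTo, Set.Finite.mem_toFinset, Set.mem_ofPred_eq, Finset.mem_filter,
    mem_degLE]
  constructor
  · rintro ⟨h1, h2, h3⟩
    refine ⟨h2, h3, ?_⟩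
    rintro rfl
    simp at h1
  · rintro ⟨h2, h3, h0⟩
    exact ⟨Nat.one_le_iff_ne_zero.2 fun h => h0 (A.eq_zero_of_deg_eq_zero h), h2, h3⟩

/-- Summing `μ * a` over the distinguished set amounts to summing `a` against shifted sums of
`μ`. -/
theorem sum_distinguishedUpTo_dirichletConv (hq : 0 < q) (S : Set G) (a : G → ℂ) (n : ℕ) :
    ∑ g ∈ A.distinguishedUpTo S n,
      A.dirichletConv (fun h => (A.moebius h : ℂ)) a g / (q : ℂ) ^ A.deg g =
    ∑ r ∈ A.degLE n, a r / (q : ℂ) ^ A.deg r * (A.shiftedSum q S r (n - A.deg r) : ℝ) := by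
  classical
  have hqc : (q : ℂ) ≠ 0 := by exact_mod_cast hq.ne'
  simp only [dirichletConv, Finset.sum_div, shiftedSum, Complex.ofReal_sum, Finset.mul_sum,
    Finset.sum_sigma']
  have hterm : ∀ r h : G, h + r ∈ A.distinguishedSet S ∧ h + r ≠ 0 →
      a r / (q : ℂ) ^ A.deg r *
        (((if h + r ∈ A.distinguishedSet S ∧ h + r ≠ 0 then (A.moebius h : ℝ) else 0) /
          q ^ A.deg h : ℝ) : ℂ) = A.moebius h * a r / (q : ℂ) ^ A.deg (h + r) := by
    intro r h hcond
    rw [if_pos hcond, map_add, pow_add]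
    push_cast
    field_simp
  symm
  refine Finset.sum_bij_ne_zero (fun x _ _ => ⟨x.2 + x.1, (x.2, x.1)⟩) ?_ ?_ ?_ ?_
  · rintro ⟨r, h⟩ hx hne
    simp only [Finset.mem_sigma, mem_degLE] at hx
    have hcond : h + r ∈ A.distinguishedSet S ∧ h + r ≠ 0 := by
      by_contra hc
      exact hne (by simp only [if_neg hc]; simp)
    simp only [Finset.mem_sigma, distinguishedUpTo, Set.Finite.mem_toFinset, Set.mem_ofPred_eq,
      and_true]
    refine ⟨Nat.one_le_iff_ne_zero.2 fun h0 => hcond.2 (A.eq_zero_of_deg_eq_zero h0), ?_, hcond.1⟩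
    rw [map_add]
    omega
  · rintro ⟨r, h⟩ _ _ ⟨r', h'⟩ _ _ heq
    simp only [Sigma.mk.injEq, heq_eq_eq, Prod.mk.injEq] at heq
    simp [heq.2.1, heq.2.2]
  · rintro ⟨g, h, r⟩ hx hne
    simp only [Finset.mem_sigma, distinguishedUpTo, Set.Finite.mem_toFinset,
      Set.mem_ofPred_eq] at hx
    obtain ⟨⟨h1, h2, h3⟩, rfl⟩ := hx
    have hcond : h + r ∈ A.distinguishedSet S ∧ h + r ≠ 0 :=
      ⟨h3, fun h0 => by rw [h0, map_zero] at h1; omega⟩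
    refine ⟨⟨r, h⟩, ?_, ?_, rfl⟩
    · simp only [Finset.mem_sigma, mem_degLE]
      rw [map_add] at h2
      omega
    · rwa [hterm r h hcond]
  · rintro ⟨r, h⟩ hx hne
    have hcond : h + r ∈ A.distinguishedSet S ∧ h + r ≠ 0 := by
      by_contra hc
      exact hne (by simp only [if_neg hc]; simp)
    exact hterm r h hcond

/-- The hypothesis on `a` gives absolute convergence of `∑ a(r) / ‖r‖`, which is all that is used:
`log log ‖r‖ ≥ 1` for all but finitely many `r`, and the exceptions, where the logarithm may be
negative, do not affect summability. -/
theorem summable_norm_div_of_tendsto (hq : 1 < q) (S : Set G) (a : G → ℂ)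
    (ha : ∀ g, g ∉ A.distinguishedSet S → a g = 0) {L : ℝ}
    (hL : Tendsto (fun n : ℕ => ∑ g ∈ A.distinguishedUpTo S n,
        ‖a g‖ / q ^ A.deg g * Real.log (Real.log (q ^ A.deg g))) atTop (𝓝 L)) :
    Summable fun r => ‖a r‖ / q ^ A.deg r := by
  classical
  have hq0 : 0 < q := zero_lt_one.trans hq
  set t : G → ℝ := fun r => ‖a r‖ / q ^ A.deg r with ht
  have ht0 : ∀ r, 0 ≤ t r := fun r => by positivity
  obtain ⟨C, hC⟩ := (Metric.isBounded_range_of_tendsto _ hL).exists_norm_le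
  have hlog : Tendsto (fun d : ℕ => Real.log (Real.log (q ^ d))) atTop atTop :=
    Real.tendsto_log_atTop.comp (Real.tendsto_log_atTop.comp (tendsto_pow_atTop_atTop_of_one_lt hq))
  obtain ⟨d₀, hd₀⟩ := (hlog.eventually_ge_atTop 1).exists_forall_of_atTop
  have hsub : ∀ {m n : ℕ}, m ≤ n → A.distinguishedUpTo S m ⊆ A.distinguishedUpTo S n := by
    intro m n hmn g hg
    simp only [distinguishedUpTo, Set.Finite.mem_toFinset, Set.mem_ofPred_eq] at hg ⊢
    exact ⟨hg.1, hg.2.1.trans hmn, hg.2.2⟩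
  refine summable_of_sum_le (c := ∑ r ∈ A.degLE d₀, t r + 2 * C) ht0 fun u => ?_
  set n := max d₀ (u.sup A.deg)
  have hn : d₀ ≤ n := le_max_left _ _
  have hle : A.degLE d₀ ⊆ A.degLE n := fun g hg => A.mem_degLE.2 ((A.mem_degLE.1 hg).trans hn)
  have h1 : ∑ r ∈ u, t r ≤ ∑ r ∈ A.degLE n, t r :=
    Finset.sum_le_sum_of_subset_of_nonneg
      (fun r hr => A.mem_degLE.2 ((Finset.le_sup (f := A.deg) hr).trans (le_max_right _ _)))
      fun r _ _ => ht0 r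
  have h2 : ∑ r ∈ A.degLE n \ A.degLE d₀, t r =
      ∑ r ∈ A.distinguishedUpTo S n \ A.distinguishedUpTo S d₀, t r := by
    symm
    refine Finset.sum_subset ?_ ?_
    · intro r hr
      simp only [Finset.mem_sdiff, distinguishedUpTo, Set.Finite.mem_toFinset, Set.mem_ofPred_eq,
        mem_degLE] at hr ⊢
      exact ⟨hr.1.2.1, fun h => hr.2 ⟨hr.1.1, h, hr.1.2.2⟩⟩
    · intro r hr hr'
      simp only [Finset.mem_sdiff, distinguishedUpTo, Set.Finite.mem_toFinset, Set.mem_ofPred_eq,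
        mem_degLE] at hr hr'
      have : r ∉ A.distinguishedSet S := fun h =>
        hr' ⟨⟨by omega, hr.1, h⟩, fun h' => hr.2 h'.2.1⟩
      simp [ht, ha r this]
  have h3 : ∑ r ∈ A.distinguishedUpTo S n \ A.distinguishedUpTo S d₀, t r ≤
      ∑ r ∈ A.distinguishedUpTo S n \ A.distinguishedUpTo S d₀,
        t r * Real.log (Real.log (q ^ A.deg r)) := by
    refine Finset.sum_le_sum fun r hr => le_mul_of_one_le_right (ht0 r) (hd₀ _ ?_)
    simp only [Finset.mem_sdiff, distinguishedUpTo, Set.Finite.mem_toFinset,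
      Set.mem_ofPred_eq] at hr
    by_contra h
    exact hr.2 ⟨hr.1.1, by omega, hr.1.2.2⟩
  have h4 := Finset.sum_sdiff (hsub hn) (f := fun r => t r * Real.log (Real.log (q ^ A.deg r)))
  have h5 := Finset.sum_sdiff hle (f := t)
  have h6 := (abs_le.1 (hC _ ⟨n, rfl⟩)).2
  have h7 := (abs_le.1 (hC _ ⟨d₀, rfl⟩)).1
  simp only at h6 h7
  linarith

/-- Dominated convergence over `r`: only `r = 0` contributes to the limit. -/
theorem AxiomASharp.tendsto_sum_dirichletConv (hA : A.AxiomASharp c q η)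
    (hs : Summable fun n => |PowerSeries.coeff n (A.regZeta q)⁻¹|) {S : Set G}
    (hS : S ⊆ A.primes) {δ : ℝ} (hδ : A.HasNaturalDensity S δ) (a : G → ℂ)
    (ha : ∀ g, g ∉ A.distinguishedSet S → a g = 0) (ha0 : a 0 = 1)
    (hsum : Summable fun r => ‖a r‖ / q ^ A.deg r) :
    Tendsto (fun n : ℕ => -∑ g ∈ A.distinguishedUpTo S n,
        A.dirichletConv (fun h => (A.moebius h : ℂ)) a g / (q : ℂ) ^ A.deg g)
        atTop (𝓝 (δ : ℂ)) := by
  classical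
  have hq := hA.q_pos
  obtain ⟨C, hC⟩ := hA.exists_sum_abs_coeff_minPrimeSeries_le hs
  obtain ⟨B, hB⟩ := hA.exists_abs_coeff_roughSeries_le hs
  have hB0 : 0 ≤ B := (abs_nonneg _).trans (hB ∅ 0)
  have hfilter : ∀ n m, |∑ P ∈ (A.primesLE m).filter fun (P : A.primes) => (P : G) ∈ S,
      PowerSeries.coeff n (A.minPrimeSeries q (A.regZeta q)⁻¹ P)| ≤ C := fun n m =>
    (Finset.abs_sum_le_sum_abs _ _).trans ((Finset.sum_le_sum_of_subset_of_nonneg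
      (Finset.filter_subset _ _) fun _ _ _ => abs_nonneg _).trans (hC n m))
  have hmin : ∀ r, r ≠ 0 → a r ≠ 0 → ∃ Q : A.primes, (Q : G) ∈ S ∧ A.IsUniqueMin Q r :=
    fun r hr har => (mem_distinguishedSet_iff hr).1 (by_contra fun h => har (ha r h))
  have hbound : ∀ r, a r ≠ 0 → ∀ n, |A.shiftedSum q S r n| ≤ C + B := by
    intro r har n
    by_cases hr : r = 0
    · rw [hr, shiftedSum_zero, abs_neg]
      linarith [hfilter n n]
    · obtain ⟨Q, hQS, hQ⟩ := hmin r hr har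
      rw [shiftedSum_eq q hQS hQ]
      refine (abs_add_le _ _).trans (add_le_add ?_ (hB _ n))
      rw [abs_neg]
      exact hfilter n _
  have hlim0 : Tendsto (fun n => A.shiftedSum q S 0 n) atTop (𝓝 (-δ)) := by
    simp only [shiftedSum_zero]
    exact (hA.tendsto_sum_filter_coeff_minPrimeSeries hs hS hδ).neg
  have hlim : ∀ r, r ≠ 0 → a r ≠ 0 → Tendsto (fun n => A.shiftedSum q S r n) atTop (𝓝 0) := by
    intro r hr har
    obtain ⟨Q, hQS, hQ⟩ := hmin r hr har
    simp only [shiftedSum_eq q hQS hQ]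
    simpa using (tendsto_finsetSum _ fun P _ =>
      tendsto_coeff_minPrimeSeries hA.one_lt_q hs P).neg.add
        (tendsto_coeff_roughSeries hA.one_lt_q hs _)
  have key := tendsto_tsum_of_dominated_convergence (𝓕 := atTop)
    (f := fun (n : ℕ) (r : G) => if A.deg r ≤ n then
      a r / (q : ℂ) ^ A.deg r * (A.shiftedSum q S r (n - A.deg r) : ℝ) else 0)
    (g := fun r => if r = 0 then -(δ : ℂ) else 0) (hsum.mul_right (C + B))
    (fun r => by
      have hev : (fun n : ℕ => if A.deg r ≤ n then
          a r / (q : ℂ) ^ A.deg r * (A.shiftedSum q S r (n - A.deg r) : ℝ) else 0) =ᶠ[atTop]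
          fun n => a r / (q : ℂ) ^ A.deg r * (A.shiftedSum q S r (n - A.deg r) : ℝ) := by
        filter_upwards [eventually_ge_atTop (A.deg r)] with n hn
        rw [if_pos hn]
      refine Tendsto.congr' hev.symm ?_
      by_cases hr : r = 0
      · subst hr
        have := (Complex.continuous_ofReal.tendsto _).comp hlim0
        simpa [ha0] using! this
      · rw [if_neg hr]
        by_cases har : a r = 0
        · simp [har]
        · have := ((Complex.continuous_ofReal.tendsto _).comp ((hlim r hr har).comp
            (tendsto_sub_atTop_nat (A.deg r)))).const_mul (a r / (q : ℂ) ^ A.deg r)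
          simpa using! this)
    (Eventually.of_forall fun n r => by
      have hnn : 0 ≤ ‖a r‖ / q ^ A.deg r := by positivity
      have hCB : 0 ≤ C + B := (abs_nonneg _).trans (hbound 0 (by simp [ha0]) 0)
      split_ifs
      · by_cases har : a r = 0
        · simp [har]
        · rw [norm_mul, norm_div, norm_pow, Complex.norm_real, Complex.norm_real, Real.norm_eq_abs,
            Real.norm_eq_abs, abs_of_pos hq]
          gcongr
          exact hbound r har _
      · rw [norm_zero]
        positivity)
  rw [tsum_ite_eq] at key
  have key' := key.neg
  rw [neg_neg] at key'
  refine key'.congr fun n => ?_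
  rw [sum_distinguishedUpTo_dirichletConv hq, tsum_eq_sum (s := A.degLE n)
    fun r hr => if_neg fun h => hr (A.mem_degLE.2 h)]
  congr 1
  exact Finset.sum_congr rfl fun r hr => if_pos (A.mem_degLE.1 hr)

end AdditiveArithmeticalSemigroup

theorem theorem1p4 {G : Type*} [AddCommMonoid G] (A : AdditiveArithmeticalSemigroup G)
    (c q η : ℝ) (hA : A.AxiomASharp c q η)
    (Z : ℂ → ℂ) (hZ : A.IsZetaFunction q η Z) (hZ0 : Z (-(q : ℂ)⁻¹) ≠ 0)
    (S : Set G) (hS : S ⊆ A.primes) (δ : ℝ) (hδ : A.HasNaturalDensity S δ) :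
    (∀ a : G → ℂ, (∀ g, g ∉ A.distinguishedSet S → a g = 0) → a 0 = 1 →
      (∃ L : ℝ, Tendsto (fun n : ℕ => ∑ g ∈ A.distinguishedUpTo S n,
        ‖a g‖ / q ^ A.deg g * Real.log (Real.log (q ^ A.deg g))) atTop (𝓝 L)) →
      Tendsto (fun n : ℕ => -∑ g ∈ A.distinguishedUpTo S n,
        A.dirichletConv (fun h => (A.moebius h : ℂ)) a g / (q : ℂ) ^ A.deg g)
        atTop (𝓝 (δ : ℂ))) ∧
    Tendsto (fun n : ℕ => -∑ g ∈ A.distinguishedUpTo S n,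
      (A.moebius g : ℝ) / q ^ A.deg g) atTop (𝓝 δ) := by
  have hs := hA.summable_abs_coeff_inv_regZeta hZ hZ0
  constructor
  · rintro a ha ha0 ⟨L, hL⟩
    exact hA.tendsto_sum_dirichletConv hs hS hδ a ha ha0
      (AdditiveArithmeticalSemigroup.summable_norm_div_of_tendsto hA.one_lt_q S a ha hL)
  · simp only [AdditiveArithmeticalSemigroup.sum_distinguishedUpTo_moebius,
      AdditiveArithmeticalSemigroup.shiftedSum_zero, neg_neg]
    exact hA.tendsto_sum_filter_coeff_minPrimeSeries hs hS hδ
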